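/- **Setting.** A *Boolean circuit* has constant, NOT, AND and OR gates; $\mathcal C:\{-1,1\}^d\to\{-1,1\}^d$ is read with $1,-1$ as the truth values. *One-way permutations exist* if there are bijections $f_d:\{-1,1\}^d\to\{-1,1\}^d$ ($d\ge 0$), computed by circuits of size $\mathrm{poly}(d)$, such that for every $T(d)=\mathrm{poly}(d)$ and every $\epsilon(d)=1/\mathrm{poly}(d)$, for all sufficiently large $d$, every circuit $\mathcal C'$ of size at most $T(d)$ satisfies $\Pr_{z\sim\{\pm1\}^d}[\mathcal C'(f_d(z))=z]\le\epsilon(d)$. For $G:\mathbb R^d\to\mathbb R^d$ and $\beta>0$, the *VAE generator* draws $z\sim\mathcal N(0,I_d)$ and $x\mid z\sim\mathcal N(G(z),\beta^2I_d)$; $x\sim G$ denotes the resulting law of $x$, and $p(z|x)$ the posterior. A *deep latent Gaussian encoder* is given by feed-forward networks $G_1,\dots,G_\ell$ ($\ell \geq 1$), whose nodes compute $\sigma(\sum_i w_iv_i+b)$, and noise parameters $\beta_1,\dots,\beta_\ell\in\mathbb R$; $E(z|x)$ is the law of $z_\ell\in\mathbb R^d$, where $z_0=x$ and $z_i=G_i(z_{i-1})+\beta_i\xi_i$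 with independent standard Gaussian vectors $\xi_i$. A function $\sigma:\mathbb R\to\mathbb R$ is *evaluable by circuits of size $s(n)$* if for every $n\ge0$ there is a Boolean circuit of size at most $s(n)$ that maps each signed binary number $a$ with $n$ integer and $n$ fractional bits to a signed binary number with $n$ fractional bits within $2^{-n}$ of $\sigma(a)$. $d_{\mathrm{TV}}(P,Q)=\sup_A|P(A)-Q(A)|$. **Theorem.** Assume that one-way permutations exist. Then there are bijections $\mathcal C=\mathcal C_d$ of $\{-1,1\}^d$ computed by circuits of size $\mathrm{poly}(d)$, and networks $G=G_d:\mathbb R^d\to\mathbb R^d$ of size $\mathrm{poly}(d)$ with activation functions $\mathrm{sgn},\min,\max$ and with $G(z)=\mathcal C(\mathrm{sgn}(z))$ for all $z$ without zero coordinates, such that the following holds. Let $\beta(d)>0$ with $\beta=o(1/\sqrt d)$, let $T(d), s(d)=\mathrm{poly}(d)$ and $\epsilon(d)=1/\mathrm{poly}(d)$, and let $L,M,W=o(\exp(\mathrm{poly}(d)))$. Then for all sufficiently large $d$, every deep latent Gaussian encoder $E$ * with at most $T(d)$ parameters in total, * with weights (and biases) bounded by $W(d)$ in absolute value, * with activation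 functions that are $L(d)$-Lipschitz and, for each $n$, evaluable to $n$ bits by Boolean circuits of size at most $s(d+n)$ (in the above sense), and * whose nodes, including the input nodes of its networks, all have values at most $M(d)$ in absolute value with probability at least $1-\exp(-d)$ over $x\sim G$ and the noise of $E$, satisfies $$\Pr_{x\sim G}\left[d_{\mathrm{TV}}\big(E(z|x),p(z|x)\big)\le\tfrac1{10}\right]\le\epsilon(d).$$ -/

import Mathlib

open MeasureTheory ProbabilityTheory Filter Asymptotics
open scoped NNReal ENNReal

noncomputable section

/-! ### Growth rates -/

/-- `T(d) = poly(d)`. -/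
def IsPolyBounded (T : ℕ → ℕ) : Prop :=
  ∃ p : Polynomial ℕ, ∀ d, T d ≤ p.eval d

/-- `ε(d) = 1 / poly(d)`. -/
def IsInversePoly (ε : ℕ → ℝ) : Prop :=
  ∃ p : Polynomial ℕ, ∀ d, 0 < ε d ∧ (ε d)⁻¹ ≤ (p.eval d : ℕ)

/-- `f(d) = o(exp(poly(d)))`. -/
def IsLittleOExpPoly (f : ℕ → ℝ) : Prop :=
  ∃ p : Polynomial ℕ, f =o[atTop] fun d => Real.exp (p.eval d : ℕ)

/-! ### Straight-line programs (directed acyclic circuits and networks)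

`Prog Γ n m` is an acyclic circuit listed in topological order, with `n` inputs and `m` wires in
total. A gate of type `Γ k` reads the first `k` wires and creates wire number `k`; the first `n`
wires are the inputs. -/

inductive Prog (Γ : ℕ → Type) (n : ℕ) : ℕ → Type
  | nil : Prog Γ n n
  | snoc {m : ℕ} (P : Prog Γ n m) (g : Γ m) : Prog Γ n (m + 1)

namespace Prog

variable {Γ : ℕ → Type} {n : ℕ} {α : Type}

/-- The values of all wires on a given input. -/
def wires (ev : ∀ k, Γ k → (Fin k → α) → α) : ∀ {m}, Prog Γ n m → (Fin n → α) → (Fin m → α)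
  | _, nil, x => x
  | _, snoc P g, x => Fin.snoc (P.wires ev x) (ev _ g (P.wires ev x))

/-- The sum of the costs of all gates. -/
def cost (c : ∀ k, Γ k → ℕ) : ∀ {m}, Prog Γ n m → ℕ
  | _, nil => 0
  | _, snoc P g => P.cost c + c _ g

/-- A property holds for every gate. -/
def AllGates (p : ∀ k, Γ k → Prop) : ∀ {m}, Prog Γ n m → Prop
  | _, nil => True
  | _, snoc P g => P.AllGates p ∧ p _ g

end Prog

/-- A circuit or network with `n` inputs and `k` outputs, each output being one of the wires. -/
structure Network (Γ : ℕ → Type) (n k : ℕ) where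
  numWires : ℕ
  prog : Prog Γ n numWires
  out : Fin k → Fin numWires

/-! ### Boolean circuits and one-way permutations

The two elements `1` and `-1` of `{-1, 1}` are represented by `true` and `false`. -/

inductive BoolGate (k : ℕ) : Type
  | const (b : Bool)
  | not (i : Fin k)
  | and (i j : Fin k)
  | or (i j : Fin k)

def BoolGate.eval (k : ℕ) : BoolGate k → (Fin k → Bool) → Bool
  | .const b, _ => b
  | .not i, v => !(v i)
  | .and i j, v => v i && v j
  | .or i j, v => v i || v j

abbrev BoolCircuit (n k : ℕ) : Type := Network BoolGate n k

namespace BoolCircuit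

def eval {n k : ℕ} (C : BoolCircuit n k) (x : Fin n → Bool) : Fin k → Bool :=
  fun i => C.prog.wires BoolGate.eval x (C.out i)

/-- The number of gates, plus the number of outputs. -/
def size {n k : ℕ} (C : BoolCircuit n k) : ℕ :=
  C.prog.cost (fun _ _ => 1) + k

end BoolCircuit

/-- `Pr_z [C'(f(z)) = z]` for uniform `z ∈ {±1}^d`. -/
def inversionProb {d : ℕ} (f : (Fin d → Bool) → (Fin d → Bool)) (C' : BoolCircuit d d) : ℝ :=
  ({z : Fin d → Bool | C'.eval (f z) = z}.ncard : ℝ) / 2 ^ d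

/-- Existence of one-way permutations against non-uniform polynomial-size inverters. -/
def OneWayPermutationsExist : Prop :=
  ∃ C : ∀ d, BoolCircuit d d,
    (∀ d, Function.Bijective (C d).eval) ∧
    IsPolyBounded (fun d => (C d).size) ∧
    ∀ (T : ℕ → ℕ) (ε : ℕ → ℝ), IsPolyBounded T → IsInversePoly ε →
      ∀ᶠ d in atTop, ∀ C' : BoolCircuit d d, C'.size ≤ T d →
        inversionProb (C d).eval C' ≤ ε d

/-! ### Neural networks -/

/-- An affine form in the values of the first `k` nodes. -/
structure Affine (k : ℕ) where
  weight : Fin k → ℝ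
  bias : ℝ

namespace Affine

def eval {k : ℕ} (a : Affine k) (v : Fin k → ℝ) : ℝ := ∑ i, a.weight i * v i + a.bias

/-- The number of parameters: one per edge, and the bias. -/
def numParams {k : ℕ} (a : Affine k) : ℕ := {i | a.weight i ≠ 0}.ncard + 1

def BoundedBy {k : ℕ} (a : Affine k) (W : ℝ) : Prop := (∀ i, |a.weight i| ≤ W) ∧ |a.bias| ≤ W

end Affine

/-- Nodes of a network with activation functions `sgn`, `min`, `max`. -/
inductive SgnMinMaxGate (k : ℕ) : Type
  | sgn (a : Affine k)
  | min (a b : Affine k)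
  | max (a b : Affine k)

namespace SgnMinMaxGate

def eval (k : ℕ) : SgnMinMaxGate k → (Fin k → ℝ) → ℝ
  | .sgn a, v => Real.sign (a.eval v)
  | .min a b, v => Min.min (a.eval v) (b.eval v)
  | .max a b, v => Max.max (a.eval v) (b.eval v)

def numParams (k : ℕ) : SgnMinMaxGate k → ℕ
  | .sgn a => a.numParams
  | .min a b => a.numParams + b.numParams
  | .max a b => a.numParams + b.numParams

end SgnMinMaxGate

/-- Neural networks with activation functions `sgn`, `min`, `max`. -/
abbrev SgnMinMaxNet (n k : ℕ) : Type := Network SgnMinMaxGate n k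

namespace SgnMinMaxNet

def eval {n k : ℕ} (N : SgnMinMaxNet n k) (x : Fin n → ℝ) : Fin k → ℝ :=
  fun i => N.prog.wires SgnMinMaxGate.eval x (N.out i)

/-- The number of parameters, plus the number of outputs. -/
def size {n k : ℕ} (N : SgnMinMaxNet n k) : ℕ :=
  N.prog.cost SgnMinMaxGate.numParams + k

end SgnMinMaxNet

/-- A node computing `σ(∑ᵢ wᵢ vᵢ + b)`, where the activation function `σ` is arbitrary and may
differ from node to node. -/
structure Neuron (k : ℕ) : Type where
  act : ℝ → ℝ
  preact : Affine k

def Neuron.eval (k : ℕ) (g : Neuron k) (v : Fin k → ℝ) : ℝ := g.act (g.preact.eval v)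

/-- Feed-forward neural networks. -/
abbrev NeuralNet (n k : ℕ) : Type := Network Neuron n k

namespace NeuralNet

/-- The values of all nodes, input nodes included. -/
def nodes {n k : ℕ} (N : NeuralNet n k) (x : Fin n → ℝ) : Fin N.numWires → ℝ :=
  N.prog.wires Neuron.eval x

def eval {n k : ℕ} (N : NeuralNet n k) (x : Fin n → ℝ) : Fin k → ℝ :=
  fun i => N.nodes x (N.out i)

/-- The number of parameters, plus the number of outputs. -/
def size {n k : ℕ} (N : NeuralNet n k) : ℕ :=
  N.prog.cost (fun _ g => g.preact.numParams) + k

def WeightsBoundedBy {n k : ℕ} (N : NeuralNet n k) (W : ℝ) : Prop :=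
  N.prog.AllGates fun _ g => g.preact.BoundedBy W

def ActivationsSatisfy {n k : ℕ} (N : NeuralNet n k) (p : (ℝ → ℝ) → Prop) : Prop :=
  N.prog.AllGates fun _ g => p g.act

end NeuralNet

/-- The dyadic number with `n` fractional bits that a bit string represents: bit `i < k` has the
value `2 ^ i / 2 ^ n`, and the last bit is the sign (`true` for negative). -/
def fixedPoint (n : ℕ) {k : ℕ} (b : Fin (k + 1) → Bool) : ℝ :=
  (if b (Fin.last k) then -1 else 1) *
    ∑ i : Fin k, (if b i.castSucc then (2 : ℝ) ^ (i : ℕ) / 2 ^ n else 0)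

/-- `σ` can be evaluated in finite precision by Boolean circuits of size `s n`: on the numbers with
sign, `n` integer bits and `n` fractional bits, up to an error of `2 ^ (-n)`. -/
def CircuitEvaluable (s : ℕ → ℕ) (σ : ℝ → ℝ) : Prop :=
  ∀ n : ℕ, ∃ (k : ℕ) (C : BoolCircuit (n + n + 1) (k + 1)), C.size ≤ s n ∧
    ∀ b, |fixedPoint n (C.eval b) - σ (fixedPoint n b)| ≤ 1 / 2 ^ n

/-! ### Latent Gaussians -/

/-- The standard Gaussian distribution on `ℝ^d`. -/
def stdNormal (d : ℕ) : Measure (Fin d → ℝ) := Measure.pi fun _ => gaussianReal 0 1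

instance (d : ℕ) : IsProbabilityMeasure (stdNormal d) := by
  unfold stdNormal; infer_instance

/-- The conditional distribution `p(x | z) = N(G(z), β² I)` of `x = G(z) + β ξ`. -/
def latentGaussian {n k : ℕ} (G : (Fin n → ℝ) → (Fin k → ℝ)) (β : ℝ) :
    Kernel (Fin n → ℝ) (Fin k → ℝ) :=
  (Kernel.id ×ₖ Kernel.const _ (stdNormal k)).map fun p => G p.1 + β • p.2

instance {n k : ℕ} (G : (Fin n → ℝ) → (Fin k → ℝ)) (β : ℝ) :
    IsFiniteKernel (latentGaussian G β) := by
  unfold latentGaussian; infer_instance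

/-- The distribution of the samples `x` of the generator: `z ∼ N(0, I)`, `x ∼ p(x | z)`. -/
def sampleLaw {n k : ℕ} (G : (Fin n → ℝ) → (Fin k → ℝ)) (β : ℝ) : Measure (Fin k → ℝ) :=
  latentGaussian G β ∘ₘ stdNormal n

/-- The posterior `p(z | x)`. -/
def posteriorLaw {n k : ℕ} (G : (Fin n → ℝ) → (Fin k → ℝ)) (β : ℝ) :
    Kernel (Fin k → ℝ) (Fin n → ℝ) :=
  posterior (latentGaussian G β) (stdNormal n)

/-! ### Deep latent Gaussians -/

/-- Deep latent Gaussians: one or more stochastic layers `z ↦ N(G(z), β² I)` in sequence. -/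
inductive DeepLatentGaussian : ℕ → ℕ → Type
  | single {a b : ℕ} (G : NeuralNet a b) (β : ℝ) : DeepLatentGaussian a b
  | cons {a b c : ℕ} (G : NeuralNet a b) (β : ℝ) (E : DeepLatentGaussian b c) :
      DeepLatentGaussian a c

/-- The law of the noise: independent standard Gaussians `ω i j` (layer `i`, coordinate `j`). -/
def noiseLaw : Measure (ℕ → ℕ → ℝ) :=
  Measure.infinitePi fun _ => Measure.infinitePi fun _ => gaussianReal 0 1

namespace DeepLatentGaussian

/-- Ancestral sampling: `z₀ = x` and `zᵢ = Gᵢ(zᵢ₋₁) + βᵢ ξᵢ`. -/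
def sample : ∀ {a c : ℕ}, DeepLatentGaussian a c → (Fin a → ℝ) → (ℕ → ℕ → ℝ) → (Fin c → ℝ)
  | _, _, single G β, x, ω => fun j => G.eval x j + β * ω 0 j
  | _, _, cons G β E, x, ω =>
      E.sample (fun j => G.eval x j + β * ω 0 j) (fun i => ω (i + 1))

/-- The conditional distribution `E(z | x)`. -/
def law {a c : ℕ} (E : DeepLatentGaussian a c) (x : Fin a → ℝ) : Measure (Fin c → ℝ) :=
  noiseLaw.map (E.sample x)

/-- During the sampling with noise `ω` from the input `x`, all nodes of all the networks have
values at most `M` in absolute value. -/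
def NodesBoundedBy : ∀ {a c : ℕ},
    DeepLatentGaussian a c → ℝ → (Fin a → ℝ) → (ℕ → ℕ → ℝ) → Prop
  | _, _, single G _, M, x, _ => ∀ i, |G.nodes x i| ≤ M
  | _, _, cons G β E, M, x, ω => (∀ i, |G.nodes x i| ≤ M) ∧
      E.NodesBoundedBy M (fun j => G.eval x j + β * ω 0 j) (fun i => ω (i + 1))

/-- A property holds for all the networks. -/
def AllNets (p : ∀ a b, NeuralNet a b → Prop) : ∀ {a c : ℕ}, DeepLatentGaussian a c → Prop
  | _, _, single G _ => p _ _ G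
  | _, _, cons G _ E => p _ _ G ∧ E.AllNets p

/-- The total number of parameters: the sizes of the networks, and one noise parameter per layer. -/
def size : ∀ {a c : ℕ}, DeepLatentGaussian a c → ℕ
  | _, _, single G _ => G.size + 1
  | _, _, cons G _ E => G.size + 1 + E.size

end DeepLatentGaussian

/-- The total variation distance of two probability measures. -/
def tvDist {Ω : Type*} [MeasurableSpace Ω] (P Q : Measure Ω) : ℝ :=
  ⨆ A : {A : Set Ω // MeasurableSet A}, |P.real A.1 - Q.real A.1|

end

/-!
# Approximating the posterior of a generator inverts a one-way permutation

The generator is the one-way permutation `f` itself, applied to the signs of the latent vector: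
Boolean gates on `±1` are `min`, `max` and negation (`exists_sgnMinMax_prog`). As the noise is
smaller than `1 / √d`, with overwhelming probability it changes no sign of `G(z)`
(`measure_exceptional_le`). So for most `x` the posterior `p(z|x)` is concentrated on those `z`
whose signs are the unique preimage of `signBits x` under `f`, and an encoder close to the posterior
in total variation outputs this preimage with probability at least `8/10`.

It remains to turn such an encoder into a Boolean circuit. The adversary is non-uniform, so that the
noise of the generator and of the encoder need not be sampled: some fixed value of it does at least
as well as the average, and this value is hardwired (`exists_noise`). Then all nodes of the encoder
are functions of the bits of `f(b)`, and a circuit evaluates them in fixed-point arithmetic. Each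
node multiplies the error by at most `errGrowth`, hence polynomially many bits keep it below `2⁻ᵈ`
(`derives_sample`, `adequatePrecision`). This is enough to read off the signs of the output, because
a Gaussian vector has no coordinate smaller than `2⁻ᵈ`, except with negligible probability.
The last layer of noise may be huge, but it can be clamped without any effect on the signs
(`derives_sign`).

Circuits are not handled wire by wire. The relation `Derives S T c` between sets of Boolean
functions of the inputs says that `c` gates suffice to get from `S` to `T`; it composes, and
arithmetic is built on it: `derives_bitFuns_add` is the ripple-carry adder on bit vectors, and
`derives_real_affine` evaluates affine forms with real coefficients in bits.
-/

/-! ### Boolean functions derived by circuits -/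

/-- Boolean functions of `n` bits. -/
abbrev BoolFun (n : ℕ) : Type := (Fin n → Bool) → Bool

/-- The functions of the inputs that the wires of a program compute. -/
def Prog.funs {n m : ℕ} (P : Prog BoolGate n m) : Set (BoolFun n) :=
  Set.range fun i x => P.wires BoolGate.eval x i

/-- `c` gates suffice to compute all functions in `T` from those in `S`: every program that
computes `S` can be prolonged by `c` gates to one that also computes `T`. Speaking of functions of
the inputs instead of wires makes this relation compose without any bookkeeping of wire numbers. -/
def Derives {n : ℕ} (S T : Set (BoolFun n)) (c : ℕ) : Prop :=
  ∀ m (P : Prog BoolGate n m), S ⊆ P.funs → ∃ m', ∃ P' : Prog BoolGate n m',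
    P.funs ⊆ P'.funs ∧ T ⊆ P'.funs ∧ P'.cost (fun _ _ => 1) ≤ P.cost (fun _ _ => 1) + c

namespace Derives

variable {n : ℕ} {S S' T U : Set (BoolFun n)} {c c' : ℕ}

theorem mono (h : Derives S T c) (hS : S ⊆ S') (hT : U ⊆ T) (hc : c ≤ c') : Derives S' U c' := by
  intro m P hP
  obtain ⟨m', P', h1, h2, h3⟩ := h m P (hS.trans hP)
  exact ⟨m', P', h1, hT.trans h2, by omega⟩

theorem of_subset (h : T ⊆ S) : Derives S T 0 :=
  fun m P hP => ⟨m, P, subset_rfl, h.trans hP, le_rfl⟩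

/-- What has been derived stays available. -/
theorem trans (h : Derives S T c) (h' : Derives (S ∪ T) U c') : Derives S (T ∪ U) (c + c') := by
  intro m P hP
  obtain ⟨m', P', h1, h2, h3⟩ := h m P hP
  obtain ⟨m'', P'', h4, h5, h6⟩ := h' m' P' (Set.union_subset (hP.trans h1) h2)
  exact ⟨m'', P'', h1.trans h4, Set.union_subset (h2.trans h4) h5, by omega⟩

theorem union (h : Derives S T c) (h' : Derives S U c') : Derives S (T ∪ U) (c + c') :=
  h.trans (h'.mono Set.subset_union_left subset_rfl le_rfl)

theorem self_union (h : Derives S T c) : Derives S (S ∪ T) c := by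
  simpa using (of_subset subset_rfl).union h

theorem comp (h : Derives S T c) (h' : Derives T U c') : Derives S U (c + c') :=
  (h.trans (h'.mono Set.subset_union_right subset_rfl le_rfl)).mono subset_rfl
    Set.subset_union_right le_rfl

theorem biUnion {ι : Type*} (s : Finset ι) (F : ι → Set (BoolFun n))
    (h : ∀ i ∈ s, Derives S (F i) c) : Derives S (⋃ i ∈ s, F i) (s.card * c) := by
  classical
  induction s using Finset.induction_on with
  | empty => simpa using of_subset (Set.empty_subset S)
  | insert a s ha ih =>
    rw [Finset.card_insert_of_notMem ha, Finset.set_biUnion_insert]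
    refine ((h a (by simp)).union (ih fun i hi => h i (by simp [hi]))).mono subset_rfl subset_rfl ?_
    ring_nf; rfl

theorem image {ι : Type*} (s : Finset ι) (f : ι → BoolFun n)
    (h : ∀ i ∈ s, Derives S {f i} c) : Derives S (f '' s) (s.card * c) :=
  (biUnion s _ h).mono subset_rfl (by rintro _ ⟨i, hi, rfl⟩; simpa using ⟨i, hi, rfl⟩) le_rfl

theorem gate {f : BoolFun n} (h : ∀ m (P : Prog BoolGate n m), S ⊆ P.funs →
    ∃ g : BoolGate m, ∀ x, g.eval m (P.wires BoolGate.eval x) = f x) : Derives S {f} 1 := by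
  intro m P hP
  obtain ⟨g, hg⟩ := h m P hP
  refine ⟨m + 1, P.snoc g, ?_, ?_, by simp [Prog.cost]⟩
  · rintro _ ⟨i, rfl⟩
    exact ⟨i.castSucc, by simp [Prog.wires]⟩
  · rintro _ rfl
    exact ⟨Fin.last m, by ext x; simp [Prog.wires, hg]⟩

theorem const (b : Bool) : Derives S {fun _ => b} 1 :=
  gate fun _ _ _ => ⟨.const b, fun _ => rfl⟩

theorem not {f : BoolFun n} (hf : f ∈ S) : Derives S {fun x => !f x} 1 :=
  gate fun _ P hP => by
    obtain ⟨i, rfl⟩ := hP hf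
    exact ⟨.not i, fun _ => rfl⟩

theorem and {f g : BoolFun n} (hf : f ∈ S) (hg : g ∈ S) : Derives S {fun x => f x && g x} 1 :=
  gate fun _ P hP => by
    obtain ⟨i, rfl⟩ := hP hf
    obtain ⟨j, rfl⟩ := hP hg
    exact ⟨.and i j, fun _ => rfl⟩

theorem or {f g : BoolFun n} (hf : f ∈ S) (hg : g ∈ S) : Derives S {fun x => f x || g x} 1 :=
  gate fun _ P hP => by
    obtain ⟨i, rfl⟩ := hP hf
    obtain ⟨j, rfl⟩ := hP hg
    exact ⟨.or i j, fun _ => rfl⟩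

theorem unary (h : Bool → Bool) {f : BoolFun n} (hf : f ∈ S) : Derives S {fun x => h (f x)} 1 := by
  rcases h1 : h true <;> rcases h0 : h false
  · convert const (S := S) false using 3 with x; cases f x <;> assumption
  · convert not hf using 3 with x; cases f x <;> assumption
  · convert (of_subset (Set.singleton_subset_iff.2 hf)).mono subset_rfl subset_rfl zero_le_one
      using 3 with x
    cases f x <;> assumption
  · convert const (S := S) true using 3 with x; cases f x <;> assumption

theorem mux {f g h : BoolFun n} (hf : f ∈ S) (hg : g ∈ S) (hh : h ∈ S) :
    Derives S {fun x => bif f x then g x else h x} 4 := by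
  have h1 := ((not hf).trans (c' := 1) (U := {fun x => !f x && h x}) (and (by simp) (by simp [hh])))
  have h2 := (and hf hg).union h1
  refine (h2.trans (or (f := fun x => f x && g x) (g := fun x => !f x && h x) (by simp)
    (by simp))).mono subset_rfl ?_ le_rfl
  rintro _ rfl
  refine Or.inr ?_
  ext x
  cases f x <;> simp

theorem binary (h : Bool → Bool → Bool) {f g : BoolFun n} (hf : f ∈ S) (hg : g ∈ S) :
    Derives S {fun x => h (f x) (g x)} 6 := by
  refine (((unary (h true) hg).union (unary (h false) hg)).trans
    (mux (f := f) (g := fun x => h true (g x)) (h := fun x => h false (g x))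
      (by simp [hf]) (by simp) (by simp))).mono subset_rfl ?_ le_rfl
  rintro _ rfl
  refine Or.inr ?_
  ext x
  cases f x <;> simp

theorem ternary (h : Bool → Bool → Bool → Bool) {f g k : BoolFun n} (hf : f ∈ S) (hg : g ∈ S)
    (hk : k ∈ S) : Derives S {fun x => h (f x) (g x) (k x)} 16 := by
  refine (((binary (h true) hg hk).union (binary (h false) hg hk)).trans
    (mux (f := f) (g := fun x => h true (g x) (k x)) (h := fun x => h false (g x) (k x))
      (by simp [hf]) (by simp) (by simp))).mono subset_rfl ?_ le_rfl
  rintro _ rfl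
  refine Or.inr ?_
  ext x
  cases f x <;> simp

/-- Substitution of available functions for the inputs of a circuit. -/
theorem subst {a m : ℕ} (P : Prog BoolGate a m) (u : Fin a → BoolFun n) (hu : ∀ i, u i ∈ S) :
    Derives S (Set.range fun i x => P.wires BoolGate.eval (fun j => u j x) i)
      (P.cost fun _ _ => 1) := by
  induction P with
  | nil => exact of_subset (by rintro _ ⟨i, rfl⟩; exact hu i)
  | snoc P g ih =>
    have key : Derives (S ∪ Set.range fun i x => P.wires BoolGate.eval (fun j => u j x) i)
        {fun x => g.eval _ (P.wires BoolGate.eval fun j => u j x)} 1 := by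
      cases g with
      | const b => exact const b
      | not i => exact not (Or.inr ⟨i, rfl⟩)
      | and i j => exact and (Or.inr ⟨i, rfl⟩) (Or.inr ⟨j, rfl⟩)
      | or i j => exact or (Or.inr ⟨i, rfl⟩) (Or.inr ⟨j, rfl⟩)
    refine (ih.trans key).mono subset_rfl ?_ le_rfl
    rintro _ ⟨i, rfl⟩
    induction i using Fin.lastCases with
    | last => exact Or.inr (by ext x; simp [Prog.wires])
    | cast i => exact Or.inl ⟨i, by ext x; simp [Prog.wires]⟩

end Derives

/-- A derivation from the inputs gives a circuit. -/
theorem Derives.exists_circuit {n k c : ℕ} {S T : Set (BoolFun n)}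
    (hS : S ⊆ Set.range fun i x => x i) (h : Derives S T c) (f : Fin k → BoolFun n)
    (hf : ∀ i, f i ∈ T) :
    ∃ C : BoolCircuit n k, C.size ≤ c + k ∧ ∀ x i, C.eval x i = f i x := by
  obtain ⟨m, P, -, h2, h3⟩ := h n Prog.nil hS
  choose o ho using fun i => h2 (hf i)
  exact ⟨⟨m, P, o⟩, by simpa [BoolCircuit.size, Prog.cost] using h3, fun x i => congrFun (ho i) x⟩

/-! ### Integer-valued sums of bits in two's complement -/

/-- The bits of a bit vector that depends on the inputs. -/
def bitFuns {n N : ℕ} (X : (Fin n → Bool) → BitVec N) : Set (BoolFun n) :=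
  (fun i x => (X x).getLsbD i) '' (Finset.range N : Set ℕ)

theorem mem_bitFuns {n N i : ℕ} {X : (Fin n → Bool) → BitVec N} (hi : i < N) :
    (fun x => (X x).getLsbD i) ∈ bitFuns X := ⟨i, by simpa using hi, rfl⟩

/-- The ripple-carry adder. -/
theorem derives_bitFuns_add {n N : ℕ} {S : Set (BoolFun n)} (X Y : (Fin n → Bool) → BitVec N)
    (hX : bitFuns X ⊆ S) (hY : bitFuns Y ⊆ S) :
    Derives S (bitFuns fun x => X x + Y x) (1 + 32 * N) := by
  have carry : ∀ k ≤ N, Derives S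
      ((fun i x => BitVec.carry i (X x) (Y x) false) '' (Finset.range (k + 1) : Set ℕ))
      (1 + 16 * k) := by
    intro k
    induction k with
    | zero => intro _; simpa [BitVec.carry_zero] using Derives.const (S := S) false
    | succ k ih =>
      intro hk
      refine ((ih (by omega)).trans (Derives.ternary Bool.atLeastTwo
        (f := fun x => (X x).getLsbD k) (g := fun x => (Y x).getLsbD k)
        (k := fun x => BitVec.carry k (X x) (Y x) false) (Or.inl (hX (mem_bitFuns (by omega))))
        (Or.inl (hY (mem_bitFuns (by omega)))) (Or.inr ⟨k, by simp, rfl⟩))).mono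
        subset_rfl ?_ (by omega)
      rintro _ ⟨i, hi, rfl⟩
      simp only [Finset.coe_range, Set.mem_Iio] at hi
      rcases Nat.lt_succ_iff_lt_or_eq.1 hi with h | rfl
      · exact Or.inl ⟨i, by simpa using h, rfl⟩
      · exact Or.inr (by ext x; simp only [BitVec.carry_succ])
  refine ((carry N le_rfl).trans (Derives.image (c := 16) (Finset.range N)
    (fun i x => (X x + Y x).getLsbD i) fun i hi => ?_)).mono subset_rfl
    Set.subset_union_right (by simp; omega)
  rw [Finset.mem_range] at hi
  simp only [BitVec.getLsbD_add hi]
  exact Derives.ternary (fun a b c => a ^^ (b ^^ c)) (f := fun x => (X x).getLsbD i)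
    (g := fun x => (Y x).getLsbD i) (k := fun x => BitVec.carry i (X x) (Y x) false)
    (Or.inl (hX (mem_bitFuns hi))) (Or.inl (hY (mem_bitFuns hi)))
    (Or.inr ⟨i, by simp; omega, rfl⟩)

/-- Modulo `2 ^ N`, an integer affine form in available bits is a sequence of additions of
constants masked by one bit each. -/
theorem derives_bitFuns_sum {n N : ℕ} {ι : Type*} {S : Set (BoolFun n)} (s : Finset ι)
    (u : ι → BoolFun n) (hu : ∀ k ∈ s, u k ∈ S) (A : ι → ℤ) (B : ℤ) :
    Derives S (bitFuns fun x => BitVec.ofInt N (∑ k ∈ s, (if u k x then A k else 0) + B))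
      (N + s.card * (33 * N + 1)) := by
  classical
  induction s using Finset.induction_on with
  | empty =>
    refine (Derives.image (c := 1) (Finset.range N) _ fun i _ => ?_).mono subset_rfl subset_rfl
      (by simp)
    simpa using Derives.const _
  | insert a s ha ih =>
    have h1 : Derives S (bitFuns fun x => if u a x then BitVec.ofInt N (A a) else 0#N) N := by
      refine (Derives.image (c := 1) (Finset.range N) _ fun i _ => ?_).mono subset_rfl subset_rfl
        (by simp)
      convert Derives.unary (fun b => bif b then (BitVec.ofInt N (A a)).getLsbD i else false)
        (hu a (by simp)) using 3 with x
      cases hx : u a x <;> simp [hx]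
    refine ((h1.union (ih fun k hk => hu k (by simp [hk]))).trans (derives_bitFuns_add
      (fun x => if u a x then BitVec.ofInt N (A a) else 0#N)
      (fun x => BitVec.ofInt N (∑ k ∈ s, (if u k x then A k else 0) + B)) ?_ ?_)).mono
      subset_rfl ?_ ?_
    · exact fun f hf => Or.inr (Or.inl hf)
    · exact fun f hf => Or.inr (Or.inr hf)
    · refine subset_trans (Eq.subset ?_) Set.subset_union_right
      congr 1
      ext1 x
      rw [Finset.sum_insert ha, add_assoc, BitVec.ofInt_add]
      cases u a x <;> simp
    · rw [Finset.card_insert_of_notMem ha]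
      ring_nf
      omega

theorem sum_testBit (m k : ℕ) :
    ∑ i : Fin k, (if m.testBit i then 2 ^ (i : ℕ) else 0) = m % 2 ^ k := by
  induction k with
  | zero => simp [Nat.mod_one]
  | succ k ih =>
    rw [Fin.sum_univ_castSucc]
    simp only [Fin.val_castSucc, Fin.val_last, ih]
    rw [Nat.mod_pow_succ, Nat.testBit_eq_decide_div_mod_eq]
    rcases Nat.mod_two_eq_zero_or_one (m / 2 ^ k) with h | h <;> simp [h]

theorem ofInt_two_complement {k : ℕ} {z : ℤ} (hz : |z| < 2 ^ k) :
    (BitVec.ofInt (k + 1) z).getLsbD k = decide (z < 0) ∧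
    (0 ≤ z → ∑ i : Fin k, (if (BitVec.ofInt (k + 1) z).getLsbD i then 2 ^ (i : ℕ) else 0)
      = z.natAbs) := by
  rw [abs_lt] at hz
  have hp : (2 : ℤ) ^ (k + 1) = 2 * 2 ^ k := by ring
  simp only [BitVec.getLsbD, BitVec.toNat_ofInt]
  rcases lt_or_ge z 0 with h | h
  · refine ⟨?_, fun h' => by omega⟩
    have : z % ((2 ^ (k + 1) : ℕ) : ℤ) = z + 2 ^ (k + 1) := by
      rw [← Int.add_emod_right, Int.emod_eq_of_lt] <;> push_cast <;> omega
    rw [this]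
    have h2 : 2 ^ k ≤ (z + 2 ^ (k + 1)).toNat := by
      zify; rw [Int.toNat_of_nonneg] <;> omega
    have h3 : (z + 2 ^ (k + 1)).toNat < 2 ^ (k + 1) := by
      zify; rw [Int.toNat_of_nonneg] <;> omega
    simp [h, Nat.testBit_of_two_pow_le_and_two_pow_add_one_gt h2 h3]
  · have : z % ((2 ^ (k + 1) : ℕ) : ℤ) = z := by
      rw [Int.emod_eq_of_lt] <;> push_cast <;> omega
    rw [this]
    have h2 : z.toNat < 2 ^ k := by zify; rw [Int.toNat_of_nonneg h]; omega
    refine ⟨by simp [Nat.testBit_lt_two_pow h2, h], fun _ => ?_⟩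
    rw [sum_testBit, Nat.mod_eq_of_lt h2]
    omega

/-- An integer affine form in available bits can be computed in signed binary. -/
theorem derives_int_affine {n : ℕ} (k : ℕ) {ι : Type*} {S : Set (BoolFun n)} (s : Finset ι)
    (u : ι → BoolFun n) (hu : ∀ j ∈ s, u j ∈ S) (A : ι → ℤ) (B : ℤ) :
    ∃ U : Fin (k + 1) → BoolFun n, Derives S (Set.range U) ((s.card + 1) * (100 * (k + 1))) ∧
      ∀ (r : ℕ) x, |∑ j ∈ s, (if u j x then A j else 0) + B| < 2 ^ k →
        fixedPoint r (fun i => U i x) =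
          ((∑ j ∈ s, (if u j x then A j else 0) + B : ℤ) : ℝ) / 2 ^ r := by
  set Z : (Fin n → Bool) → ℤ := fun x => ∑ j ∈ s, (if u j x then A j else 0) + B with hZ
  have hpos := derives_bitFuns_sum (N := k + 1) s u hu A B
  -- both the sum and its negative are computed; the sign bit selects the nonnegative one
  have hneg := derives_bitFuns_sum (N := k + 1) s u hu (fun j => -A j) (-B)
  have hZ' : (fun x => BitVec.ofInt (k + 1) (∑ j ∈ s, (if u j x then -A j else 0) + -B)) =
      fun x => BitVec.ofInt (k + 1) (-Z x) := by
    ext1 x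
    congr 1
    rw [hZ, neg_add, ← Finset.sum_neg_distrib]
    congr 1
    exact Finset.sum_congr rfl fun j _ => by split_ifs <;> simp
  rw [hZ'] at hneg
  change Derives S (bitFuns fun x => BitVec.ofInt (k + 1) (Z x)) _ at hpos
  refine ⟨Fin.snoc (fun i x => bif (BitVec.ofInt (k + 1) (Z x)).getLsbD k then
    (BitVec.ofInt (k + 1) (-Z x)).getLsbD i else (BitVec.ofInt (k + 1) (Z x)).getLsbD i)
    (fun x => (BitVec.ofInt (k + 1) (Z x)).getLsbD k), ?_, ?_⟩
  · refine ((hpos.union hneg).trans (Derives.image (c := 4) (Finset.range k)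
      (fun i x => bif (BitVec.ofInt (k + 1) (Z x)).getLsbD k then
        (BitVec.ofInt (k + 1) (-Z x)).getLsbD i else (BitVec.ofInt (k + 1) (Z x)).getLsbD i)
        fun i hi => Derives.mux (f := fun x => (BitVec.ofInt (k + 1) (Z x)).getLsbD k)
          (g := fun x => (BitVec.ofInt (k + 1) (-Z x)).getLsbD i)
          (h := fun x => (BitVec.ofInt (k + 1) (Z x)).getLsbD i) ?_ ?_ ?_)).mono subset_rfl ?_ ?_
    · exact Or.inr (Or.inl (mem_bitFuns (by omega)))
    · exact Or.inr (Or.inr (mem_bitFuns (by simp at hi; omega)))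
    · exact Or.inr (Or.inl (mem_bitFuns (by simp at hi; omega)))
    · rintro _ ⟨i, rfl⟩
      induction i using Fin.lastCases with
      | last => rw [Fin.snoc_last]; exact Or.inl (Or.inl (mem_bitFuns (by omega)))
      | cast i => rw [Fin.snoc_castSucc]; exact Or.inr ⟨i, by simp, rfl⟩
    · simp only [Finset.card_range]; nlinarith [Nat.zero_le (s.card * k)]
  · intro r x hx
    change |Z x| < 2 ^ k at hx
    change _ = ((Z x : ℤ) : ℝ) / 2 ^ r
    simp only [fixedPoint, Fin.snoc_last, Fin.snoc_castSucc]
    obtain ⟨h1, h2⟩ := ofInt_two_complement hx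
    obtain ⟨-, h4⟩ := ofInt_two_complement (z := -Z x) (by rwa [abs_neg])
    have key : ∀ v : ℕ → Bool, ∑ i : Fin k, (if v i then (2 : ℝ) ^ (i : ℕ) / 2 ^ r else 0) =
        ((∑ i : Fin k, (if v i then 2 ^ (i : ℕ) else 0) : ℕ) : ℝ) / 2 ^ r := by
      intro v
      push_cast
      rw [Finset.sum_div]
      exact Finset.sum_congr rfl fun i _ => by split_ifs <;> simp
    rw [h1]
    rcases lt_or_ge (Z x) 0 with h | h
    · simp only [h, decide_true, if_true, cond_true]
      rw [key fun i => (BitVec.ofInt (k + 1) (-Z x)).getLsbD i, h4 (by omega)]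
      have : (((-Z x).natAbs : ℕ) : ℝ) = -(Z x : ℝ) := by
        rw [Nat.cast_natAbs, abs_of_nonneg (by omega)]; push_cast; rfl
      rw [this]; ring
    · simp only [not_lt.2 h, decide_false, cond_false]
      rw [key fun i => (BitVec.ofInt (k + 1) (Z x)).getLsbD i, h2 h]
      have : (((Z x).natAbs : ℕ) : ℝ) = (Z x : ℝ) := by
        rw [Nat.cast_natAbs, abs_of_nonneg h]
      rw [this]; simp

/-- A real affine form in available bits can be computed up to rounding of its coefficients. -/
theorem derives_real_affine {n : ℕ} (r : ℕ) {ι : Type*} {S : Set (BoolFun n)} (s : Finset ι)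
    (u : ι → BoolFun n) (hu : ∀ j ∈ s, u j ∈ S) (a : ι → ℝ) (b : ℝ) :
    ∃ U : Fin (r + r + 1) → BoolFun n,
      Derives S (Set.range U) ((s.card + 1) * (100 * (r + r + 1))) ∧
      ∀ x, |∑ j ∈ s, (if u j x then a j else 0) + b| + (s.card + 1) / 2 ^ r < 2 ^ r →
        |fixedPoint r (fun i => U i x) - (∑ j ∈ s, (if u j x then a j else 0) + b)| ≤
          (s.card + 1) / 2 ^ r := by
  obtain ⟨U, hU, h⟩ := derives_int_affine (r + r) s u hu (fun j => round (a j * 2 ^ r))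
    (round (b * 2 ^ r))
  refine ⟨U, hU, fun x hx => ?_⟩
  specialize h r x
  set Z : ℤ := ∑ j ∈ s, (if u j x then round (a j * 2 ^ r) else 0) + round (b * 2 ^ r)
  set V : ℝ := ∑ j ∈ s, (if u j x then a j else 0) + b with hV
  have hp : (0 : ℝ) < 2 ^ r := by positivity
  have hZV : |(Z : ℝ) - V * 2 ^ r| ≤ s.card + 1 := by
    have : (Z : ℝ) - V * 2 ^ r = ∑ j ∈ s, (if u j x then
        ((round (a j * 2 ^ r) : ℝ) - a j * 2 ^ r) else 0) + (round (b * 2 ^ r) - b * 2 ^ r) := by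
      simp only [Z, hV]
      push_cast
      rw [add_mul, Finset.sum_mul, add_sub_add_comm, ← Finset.sum_sub_distrib]
      congr 1
      exact Finset.sum_congr rfl fun j _ => by split_ifs <;> simp
    rw [this]
    have hr : ∀ t : ℝ, |(round t : ℝ) - t| ≤ 1 := fun t => by
      rw [abs_sub_comm]; exact (abs_sub_round t).trans (by norm_num)
    refine (abs_add_le _ _).trans (add_le_add ((Finset.abs_sum_le_sum_abs _ _).trans ?_) (hr _))
    refine (Finset.sum_le_card_nsmul _ _ 1 fun j _ => ?_).trans (by simp)
    split_ifs
    · exact hr _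
    · simp
  have hdiv : |(Z : ℝ) / 2 ^ r - V| ≤ (s.card + 1) / 2 ^ r := by
    rw [le_div_iff₀ hp, ← abs_of_pos hp, ← abs_mul, abs_of_pos hp, sub_mul,
      div_mul_cancel₀ _ hp.ne']
    exact hZV
  rw [h]
  · exact hdiv
  · have h3 : |(Z : ℝ) / 2 ^ r| < 2 ^ r := by
      have := abs_sub_abs_le_abs_sub ((Z : ℝ) / 2 ^ r) V
      linarith
    rw [abs_div, abs_of_pos hp, div_lt_iff₀ hp, ← pow_add] at h3
    exact_mod_cast h3

/-! ### Simulation of encoders by circuits in fixed-point arithmetic -/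

theorem Prog.AllGates.mono {Γ : ℕ → Type} {n m : ℕ} {P : Prog Γ n m} {p q : ∀ k, Γ k → Prop}
    (h : P.AllGates p) (hpq : ∀ k g, p k g → q k g) : P.AllGates q := by
  induction P with
  | nil => trivial
  | snoc P g ih => exact ⟨ih h.1, hpq _ _ h.2⟩

theorem Prog.AllGates.and {Γ : ℕ → Type} {n m : ℕ} {P : Prog Γ n m} {p q : ∀ k, Γ k → Prop}
    (h : P.AllGates p) (h' : P.AllGates q) : P.AllGates fun k g => p k g ∧ q k g := by
  induction P with
  | nil => trivial
  | snoc P g ih => exact ⟨ih h.1 h'.1, h.2, h'.2⟩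

/-- On all inputs in `Y`, the real function `v` is approximated up to `e` by a signed binary number
with `r` fractional bits and at most `K` bits, which are among the functions in `S`. -/
def Represented {d : ℕ} (S : Set (BoolFun d)) (Y : Set (Fin d → Bool)) (r K : ℕ) (e : ℝ)
    (v : (Fin d → Bool) → ℝ) : Prop :=
  ∃ k ≤ K, ∃ U : Fin (k + 1) → BoolFun d, (∀ i, U i ∈ S) ∧
    ∀ y ∈ Y, |fixedPoint r (fun i => U i y) - v y| ≤ e

/-- A bound for the rounding errors in an affine form with `T` arguments of `K` bits. -/
noncomputable def roundErr (r K T : ℕ) : ℝ := (2 * T * K + 1) / 2 ^ r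

/-- The number of gates that suffice for one node. -/
def nodeCost (r K T : ℕ) : ℕ := (2 * T * K + 1) * (200 * (r + 1)) + K

/-- The factor by which the error may grow in one node. -/
noncomputable def errGrowth (T : ℕ) (Q : ℝ) : ℝ := Q * (T * Q + 1) + 1

/-- Numbers with `r` integer and `r` fractional bits do not overflow in the simulation of networks
whose nodes have at most `T` inputs and whose weights and values are bounded by `Q`. -/
structure AdequatePrecision (r K T : ℕ) (Q : ℝ) : Prop where
  one_le_T : 1 ≤ T
  one_le_Q : 1 ≤ Q
  bits_le : r + r ≤ K
  range : (T * Q + 1) * (Q + 2) ≤ 2 ^ r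

section

variable {d : ℕ} {S S' : Set (BoolFun d)} {Y : Set (Fin d → Bool)} {r K T : ℕ} {Q e e' : ℝ}

theorem Represented.mono {v : (Fin d → Bool) → ℝ} (h : Represented S Y r K e v) (hS : S ⊆ S')
    (he : e ≤ e') : Represented S' Y r K e' v := by
  obtain ⟨k, hk, U, hU, h⟩ := h
  exact ⟨k, hk, U, fun i => hS (hU i), fun y hy => (h y hy).trans he⟩

theorem roundErr_nonneg (r K T : ℕ) : 0 ≤ roundErr r K T := by unfold roundErr; positivity

theorem roundErr_mono {t : ℕ} (h : t ≤ T) : roundErr r K t ≤ roundErr r K T := by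
  unfold roundErr; gcongr

/-- A signed binary number is linear in its bits `bⱼ` and the products of `bⱼ` with the sign bit, as
`(-1) ^ σ * bⱼ = bⱼ - 2 * (bⱼ * σ)`. -/
theorem fixedPoint_eq_sum (r : ℕ) {k : ℕ} (b : Fin (k + 1) → Bool) :
    fixedPoint r b = ∑ p : Fin k × Bool,
      (if b p.1.castSucc && (!p.2 || b (Fin.last k)) then
        (2 : ℝ) ^ (p.1 : ℕ) / 2 ^ r * (if p.2 then -2 else 1) else 0) := by
  rw [fixedPoint, Finset.mul_sum, Fintype.sum_prod_type]
  refine Finset.sum_congr rfl fun j _ => ?_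
  rw [Fintype.sum_bool]
  cases b (Fin.last k) <;> cases b j.castSucc <;> simp
  ring

/-- An affine form in represented values can be computed in fixed-point arithmetic. -/
theorem derives_affine {ι : Type*} (I : Finset ι) (v : ι → (Fin d → Bool) → ℝ)
    (hv : ∀ i, Represented S Y r K e (v i)) (he : 0 ≤ e) (w : ι → ℝ) (hw : ∀ i, |w i| ≤ Q)
    (hQ : 0 ≤ Q) (b : ℝ) (hI : I.card ≤ T) :
    ∃ U : Fin (r + r + 1) → BoolFun d,
      Derives S (Set.range U) ((2 * T * K + 1) * (200 * (r + 1))) ∧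
      ∀ y ∈ Y, |∑ i ∈ I, w i * v i y + b| + (T * Q * e + roundErr r K T) < 2 ^ r →
        |fixedPoint r (fun i => U i y) - (∑ i ∈ I, w i * v i y + b)| ≤
          T * Q * e + roundErr r K T := by
  choose k hk V hVS hV using hv
  set s : Finset (Σ i, Fin (k i) × Bool) := I.sigma fun _ => Finset.univ with hs
  have hcard : s.card ≤ 2 * T * K := by
    rw [hs, Finset.card_sigma]
    refine (Finset.sum_le_card_nsmul I _ (2 * K) fun i _ => ?_).trans ?_
    · simp only [Finset.card_univ, Fintype.card_prod, Fintype.card_fin, Fintype.card_bool]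
      have := hk i
      omega
    · rw [smul_eq_mul]; nlinarith
  let u : (Σ i, Fin (k i) × Bool) → BoolFun d := fun p y =>
    V p.1 p.2.1.castSucc y && (!p.2.2 || V p.1 (Fin.last _) y)
  have hu : Derives S (u '' (s : Set _)) (s.card * 1) := by
    refine Derives.image s u fun p _ => ?_
    obtain ⟨i, j, c⟩ := p
    cases c
    · exact (Derives.of_subset (by rintro _ rfl; simpa [u] using hVS _ _)).mono subset_rfl
        subset_rfl zero_le_one
    · simpa [u] using Derives.and (hVS i j.castSucc) (hVS i (Fin.last _))
  obtain ⟨U, hU, hU'⟩ := derives_real_affine (S := u '' (s : Set _)) r s u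
    (fun p hp => ⟨p, hp, rfl⟩)
    (fun p => w p.1 * ((2 : ℝ) ^ (p.2.1 : ℕ) / 2 ^ r * (if p.2.2 then -2 else 1))) b
  refine ⟨U, (hu.comp hU).mono subset_rfl subset_rfl ?_, fun y hy hrange => ?_⟩
  · nlinarith [Nat.mul_le_mul_right (200 * r + 101) hcard]
  have hsum : ∑ p ∈ s, (if u p y then
      w p.1 * ((2 : ℝ) ^ (p.2.1 : ℕ) / 2 ^ r * (if p.2.2 then -2 else 1)) else 0) =
      ∑ i ∈ I, w i * fixedPoint r fun j => V i j y := by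
    rw [hs, Finset.sum_sigma]
    refine Finset.sum_congr rfl fun i _ => ?_
    rw [fixedPoint_eq_sum, Finset.mul_sum]
    exact Finset.sum_congr rfl fun p _ => by simp only [u, mul_ite, mul_zero]
  specialize hU' y
  rw [hsum] at hU'
  have hround : ((s.card : ℝ) + 1) / 2 ^ r ≤ roundErr r K T := by
    unfold roundErr; gcongr; exact_mod_cast hcard
  have hdiff : |(∑ i ∈ I, w i * fixedPoint r (fun j => V i j y) + b) -
      (∑ i ∈ I, w i * v i y + b)| ≤ T * Q * e := by
    rw [add_sub_add_right_eq_sub, ← Finset.sum_sub_distrib]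
    refine (Finset.abs_sum_le_sum_abs _ _).trans ((Finset.sum_le_card_nsmul I _ (Q * e)
      fun i _ => ?_).trans ?_)
    · rw [← mul_sub, abs_mul]
      exact mul_le_mul (hw i) (hV i y hy) (abs_nonneg _) hQ
    · rw [nsmul_eq_mul, mul_assoc]; gcongr
  have h3 := abs_sub_abs_le_abs_sub (∑ i ∈ I, w i * fixedPoint r (fun j => V i j y) + b)
    (∑ i ∈ I, w i * v i y + b)
  have h4 := hU' (by linarith)
  refine (abs_sub_le _ (∑ i ∈ I, w i * fixedPoint r (fun j => V i j y) + b) _).trans ?_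
  linarith

/-- A single value plus a constant, such as the noise added by a stochastic layer. -/
theorem derives_add_const (hp : AdequatePrecision r K T Q) {v : (Fin d → Bool) → ℝ}
    (hv : Represented S Y r K e v) (he : 0 ≤ e) (b : ℝ) :
    ∃ U : Fin (r + r + 1) → BoolFun d, Derives S (Set.range U) (nodeCost r K T) ∧
      ∀ y ∈ Y, |v y + b| + (e + roundErr r K T) < 2 ^ r →
        |fixedPoint r (fun i => U i y) - (v y + b)| ≤ e + roundErr r K T := by
  obtain ⟨U, hU, h⟩ := derives_affine (Finset.univ : Finset Unit) (fun _ => v) (fun _ => hv) he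
    (fun _ => 1) (Q := 1) (by simp) zero_le_one b (T := 1) (by simp)
  have hr : roundErr r K 1 ≤ roundErr r K T := roundErr_mono hp.one_le_T
  refine ⟨U, hU.mono subset_rfl subset_rfl ?_, fun y hy hy' => ?_⟩
  · unfold nodeCost
    exact le_add_right (by gcongr; exact hp.one_le_T)
  · have := h y hy
    simp only [Finset.univ_unique, Finset.sum_const, Finset.card_singleton, one_smul, one_mul,
      Nat.cast_one] at this
    exact (this (by linarith)).trans (by linarith)

theorem two_le_errGrowth (hp : AdequatePrecision r K T Q) : 2 ≤ errGrowth T Q := by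
  have h1 := hp.one_le_Q
  have h2 : (1 : ℝ) ≤ T * Q + 1 := by
    have : (0 : ℝ) ≤ T * Q := by positivity
    linarith
  unfold errGrowth
  nlinarith

/-- One node: the affine form, followed by the given circuit for the activation function. -/
theorem derives_neuron (hp : AdequatePrecision r K T Q) {m : ℕ} (g : Neuron m)
    (v : Fin m → (Fin d → Bool) → ℝ) (hv : ∀ i, Represented S Y r K e (v i))
    (hκ : roundErr r K T ≤ e) (he : e ≤ 1) (hT : g.preact.numParams ≤ T)
    (hw : g.preact.BoundedBy Q) {L : ℝ≥0} (hL : LipschitzWith L g.act) (hLQ : (L : ℝ) ≤ Q)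
    {s : ℕ → ℕ} (hs : CircuitEvaluable s g.act) (hsK : s r ≤ K)
    (hb : ∀ y ∈ Y, ∀ i, |v i y| ≤ Q) :
    ∃ S', Derives S S' (nodeCost r K T) ∧
      Represented S' Y r K (errGrowth T Q * e) fun y => g.eval m fun i => v i y := by
  have hQ := hp.one_le_Q
  have he0 : 0 ≤ e := (roundErr_nonneg _ _ _).trans hκ
  obtain ⟨act, a⟩ := g
  simp only at hL hs
  obtain ⟨hw, hbias⟩ := hw
  set I : Finset (Fin m) := Finset.univ.filter fun i => a.weight i ≠ 0 with hI
  have hcard : I.card ≤ T := by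
    have : I.card = {i | a.weight i ≠ 0}.ncard := by
      rw [← Set.ncard_coe_finset]; simp [hI]
    unfold Affine.numParams at hT
    simp only at hT
    omega
  obtain ⟨U, hU, hU'⟩ := derives_affine I v hv he0 a.weight hw (by linarith) a.bias hcard
  obtain ⟨k, C, hC, hC'⟩ := hs r
  have hkK : k + 1 ≤ K := (Nat.le_add_left _ _).trans (hC.trans hsK)
  refine ⟨_, (hU.comp (Derives.subst C.prog U fun i => ⟨i, rfl⟩)).mono subset_rfl subset_rfl ?_,
    k, by omega, fun j y => C.eval (fun i => U i y) j, fun i => ⟨C.out i, rfl⟩, fun y hy => ?_⟩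
  · unfold BoolCircuit.size at hC
    unfold nodeCost
    omega
  have hpre : ∑ i ∈ I, a.weight i * v i y + a.bias = a.eval fun i => v i y := by
    unfold Affine.eval
    congr 1
    refine Finset.sum_subset (Finset.subset_univ _) fun i _ hi => ?_
    have : a.weight i = 0 := by simpa [hI] using hi
    simp [this]
  have hpre_le : |∑ i ∈ I, a.weight i * v i y + a.bias| ≤ T * Q * Q + Q := by
    refine (abs_add_le _ _).trans (add_le_add ((Finset.abs_sum_le_sum_abs _ _).trans
      ((Finset.sum_le_card_nsmul I _ (Q * Q) fun i _ => ?_).trans ?_)) hbias)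
    · rw [abs_mul]
      exact mul_le_mul (hw i) (hb y hy i) (abs_nonneg _) (by linarith)
    · rw [nsmul_eq_mul, mul_assoc]; gcongr
  have hTQ : (0 : ℝ) ≤ T * Q := by positivity
  have h1 := hU' y hy (by nlinarith [hp.range, mul_le_mul_of_nonneg_left he hTQ])
  rw [hpre] at h1
  have h2 := hC' fun i => U i y
  have h3 : |act (fixedPoint r fun i => U i y) - act (a.eval fun i => v i y)| ≤
      Q * (T * Q * e + roundErr r K T) := by
    have := hL.dist_le_mul (fixedPoint r fun i => U i y) (a.eval fun i => v i y)
    rw [Real.dist_eq, Real.dist_eq] at this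
    exact this.trans (mul_le_mul hLQ h1 (abs_nonneg _) (by linarith))
  have h4 : (1 : ℝ) / 2 ^ r ≤ e := by
    refine le_trans ?_ hκ
    unfold roundErr
    gcongr
    have : (0 : ℝ) ≤ 2 * T * K := by positivity
    linarith
  calc _ ≤ _ := abs_sub_le _ (act (fixedPoint r fun i => U i y)) _
    _ ≤ 1 / 2 ^ r + Q * (T * Q * e + roundErr r K T) := add_le_add h2 h3
    _ ≤ e + Q * (T * Q * e + e) := by gcongr
    _ = _ := by unfold errGrowth; ring

/-- A node that can be simulated: its parameters are bounded by `Q`, and its activation function is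
`L`-Lipschitz and evaluable by circuits of size `s`. -/
def AdmissibleNeuron (s : ℕ → ℕ) (L : ℝ≥0) (Q : ℝ) {k : ℕ} (g : Neuron k) : Prop :=
  g.preact.BoundedBy Q ∧ LipschitzWith L g.act ∧ CircuitEvaluable s g.act

theorem pow_mul_le_of_le {R : ℝ} (hR : 1 ≤ R) {a b : ℕ} (hab : a ≤ b) (he : 0 ≤ e) :
    R ^ a * e ≤ R ^ b * e :=
  mul_le_mul_of_nonneg_right (pow_le_pow_right₀ hR hab) he

theorem le_pow_mul {R : ℝ} (hR : 1 ≤ R) (a : ℕ) (he : 0 ≤ e) : e ≤ R ^ a * e := by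
  simpa using pow_mul_le_of_le hR (Nat.zero_le a) he

/-- A network: the error grows by the factor `errGrowth T Q` per node, and every node has at least
one parameter, its bias. -/
theorem derives_prog (hp : AdequatePrecision r K T Q) {a m : ℕ} (P : Prog Neuron a m)
    (x : Fin a → (Fin d → Bool) → ℝ) (hx : ∀ i, Represented S Y r K e (x i))
    (hκ : roundErr r K T ≤ e) (hT : P.cost (fun _ g => g.preact.numParams) ≤ T)
    (he : errGrowth T Q ^ P.cost (fun _ g => g.preact.numParams) * e ≤ 1)
    {L : ℝ≥0} (hLQ : (L : ℝ) ≤ Q) {s : ℕ → ℕ} (hsK : s r ≤ K)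
    (hP : P.AllGates fun _ g => AdmissibleNeuron s L Q g)
    (hb : ∀ y ∈ Y, ∀ i, |P.wires Neuron.eval (fun j => x j y) i| ≤ Q) :
    ∃ S', Derives S S' (P.cost (fun _ g => g.preact.numParams) * nodeCost r K T) ∧
      ∀ i, Represented S' Y r K (errGrowth T Q ^ P.cost (fun _ g => g.preact.numParams) * e)
        fun y => P.wires Neuron.eval (fun j => x j y) i := by
  have he0 : 0 ≤ e := (roundErr_nonneg _ _ _).trans hκ
  have hR := two_le_errGrowth hp
  have hR1 : 1 ≤ errGrowth T Q := by linarith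
  induction P with
  | nil => exact ⟨S, (Derives.of_subset subset_rfl).mono subset_rfl subset_rfl (Nat.zero_le _),
      fun i => by simpa [Prog.cost, Prog.wires] using hx i⟩
  | snoc P g ih =>
    set c := P.cost fun _ g => g.preact.numParams with hc
    have hcost : (P.snoc g).cost (fun _ g => g.preact.numParams) = c + g.preact.numParams := rfl
    rw [hcost] at hT he ⊢
    have hg1 : 1 ≤ g.preact.numParams := Nat.le_add_left _ _
    have hstep : errGrowth T Q * (errGrowth T Q ^ c * e) ≤
        errGrowth T Q ^ (c + g.preact.numParams) * e := by
      rw [← mul_assoc, ← pow_succ']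
      exact pow_mul_le_of_le hR1 (by omega) he0
    have hle : errGrowth T Q ^ c * e ≤ errGrowth T Q ^ (c + g.preact.numParams) * e :=
      pow_mul_le_of_le hR1 (by omega) he0
    have hwires : ∀ y (i : Fin _), (P.snoc g).wires Neuron.eval (fun j => x j y) i.castSucc =
        P.wires Neuron.eval (fun j => x j y) i := fun y i => by simp [Prog.wires]
    have hb' : ∀ y ∈ Y, ∀ i, |P.wires Neuron.eval (fun j => x j y) i| ≤ Q := fun y hy i => by
      rw [← hwires]; exact hb y hy _
    obtain ⟨S₁, hS₁, hrep⟩ := ih (by omega) (hle.trans he) hP.1 hb'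
    obtain ⟨S₂, hS₂, hrep'⟩ := derives_neuron hp g _ hrep
      (hκ.trans (le_pow_mul hR1 _ he0)) (hle.trans he) (by omega) hP.2.1 hP.2.2.1 hLQ hP.2.2.2 hsK
      hb'
    refine ⟨_, (hS₁.comp hS₂.self_union).mono subset_rfl subset_rfl ?_, fun i => ?_⟩
    · rw [← Nat.succ_mul]
      exact Nat.mul_le_mul_right _ (by omega)
    · induction i using Fin.lastCases with
      | last => simpa [Prog.wires] using hrep'.mono Set.subset_union_right hstep
      | cast i => simpa only [hwires] using (hrep i).mono Set.subset_union_left hle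

/-- The sign of `t + c` where `|t| ≤ q` and `c` is a hardwired noise term, possibly far larger than
the numbers in the simulation: clamping `c` does not change the sign. -/
theorem derives_sign (hp : AdequatePrecision r K T Q) {v : (Fin d → Bool) → ℝ}
    (hv : Represented S Y r K e v) (hκ : roundErr r K T ≤ e) (he : e + roundErr r K T ≤ 1)
    (hb : ∀ y ∈ Y, |v y| ≤ Q) (c : ℝ) :
    ∃ h : BoolFun d, Derives S {h} (nodeCost r K T + 1) ∧
      ∀ y ∈ Y, e + roundErr r K T < |v y + c| → h y = decide (0 < v y + c) := by
  have hQ := hp.one_le_Q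
  set c' : ℝ := max (-(Q + 2)) (min c (Q + 2)) with hc'
  obtain ⟨U, hU, h⟩ := derives_add_const hp hv ((roundErr_nonneg _ _ _).trans hκ) c'
  refine ⟨fun y => !(U (Fin.last _) y), (hU.comp (Derives.not ⟨Fin.last _, rfl⟩)),
    fun y hy hδ => ?_⟩
  have hvy := abs_le.1 (hb y hy)
  have hrange : 2 * (Q + 2) ≤ 2 ^ r := by
    refine le_trans ?_ hp.range
    have : (1 : ℝ) ≤ T * Q := by
      have : (1 : ℝ) ≤ T := by exact_mod_cast hp.one_le_T
      nlinarith
    gcongr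
    linarith
  have hc1 : -(Q + 2) ≤ c' := le_max_left _ _
  have hc2 : c' ≤ Q + 2 := max_le (by linarith) (min_le_right _ _)
  have habs : |v y + c'| ≤ 2 * Q + 2 := abs_le.2 ⟨by linarith, by linarith⟩
  have h1 := abs_le.1 (h y hy (by linarith))
  have hnonneg : 0 ≤ ∑ i : Fin (r + r), (if U i.castSucc y then (2 : ℝ) ^ (i : ℕ) / 2 ^ r else 0) :=
    Finset.sum_nonneg fun i _ => by split_ifs <;> positivity
  rcases le_or_gt (v y + c) 0 with hs | hs
  · have : c' ≤ max (-(Q + 2)) c := max_le_max le_rfl (min_le_left _ _)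
    rw [abs_of_nonpos hs] at hδ
    have h2 : v y + c' < -(e + roundErr r K T) := by
      rcases max_cases (-(Q + 2)) c with hm | hm <;> linarith
    have h3 : fixedPoint r (fun i => U i y) < 0 := by linarith
    rcases hlast : U (Fin.last _) y with _ | _
    · simp only [fixedPoint, hlast] at h3
      exact absurd h3 (not_lt.2 (by simpa using hnonneg))
    · simp [not_lt.2 hs, hlast]
  · have : min c (Q + 2) ≤ c' := le_max_right _ _
    rw [abs_of_pos hs] at hδ
    have h2 : e + roundErr r K T < v y + c' := by
      rcases min_cases c (Q + 2) with hm | hm <;> linarith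
    have h3 : 0 < fixedPoint r (fun i => U i y) := by linarith
    rcases hlast : U (Fin.last _) y with _ | _
    · simp [hs, hlast]
    · simp only [fixedPoint, hlast] at h3
      exact absurd h3 (not_lt.2 (by simpa using hnonneg))

theorem DeepLatentGaussian.NodesBoundedBy.abs_input_le {a c : ℕ} {E : DeepLatentGaussian a c}
    {z : Fin a → ℝ} {ω : ℕ → ℕ → ℝ} (h : E.NodesBoundedBy Q z ω) (j : Fin a) : |z j| ≤ Q := by
  have hin : ∀ {m : ℕ} (P : Prog Neuron a m), (∀ i, |P.wires Neuron.eval z i| ≤ Q) → |z j| ≤ Q := by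
    intro m P
    induction P with
    | nil => exact fun h => h j
    | snoc P g ih => exact fun h => ih fun i => by simpa [Prog.wires] using h i.castSucc
  cases E with
  | single G β => exact hin G.prog h
  | cons G β E => exact hin G.prog h.1

/-- For a fixed value `ω` of the noise, circuits compute the signs of the coordinates of the sample,
as long as these are not too close to zero. -/
theorem derives_sample (hp : AdequatePrecision r K T Q) {a c : ℕ} (E : DeepLatentGaussian a c)
    (ω : ℕ → ℕ → ℝ) (x : Fin a → (Fin d → Bool) → ℝ) (hx : ∀ i, Represented S Y r K e (x i))
    (hκ : roundErr r K T ≤ e) (hT : E.size ≤ T) (he : errGrowth T Q ^ E.size * e ≤ 1)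
    {L : ℝ≥0} (hLQ : (L : ℝ) ≤ Q) {s : ℕ → ℕ} (hsK : s r ≤ K)
    (hE : E.AllNets fun _ _ N => N.prog.AllGates fun _ g => AdmissibleNeuron s L Q g)
    (hb : ∀ y ∈ Y, E.NodesBoundedBy Q (fun j => x j y) ω) :
    ∃ h : Fin c → BoolFun d, Derives S (Set.range h) (E.size * (nodeCost r K T + 1)) ∧
      ∀ y ∈ Y, ∀ j, errGrowth T Q ^ E.size * e < |E.sample (fun j => x j y) ω j| →
        h j y = decide (0 < E.sample (fun j => x j y) ω j) := by
  have hR := two_le_errGrowth hp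
  have hR1 : 1 ≤ errGrowth T Q := by linarith
  induction E generalizing S e ω with
  | @single a c G β =>
    have he0 : 0 ≤ e := (roundErr_nonneg _ _ _).trans hκ
    set C := G.prog.cost fun _ g => g.preact.numParams with hC
    have hsize : (DeepLatentGaussian.single G β).size = C + c + 1 := rfl
    rw [hsize] at hT he ⊢
    have hle : errGrowth T Q ^ C * e ≤ errGrowth T Q ^ (C + c + 1) * e :=
      pow_mul_le_of_le hR1 (by omega) he0
    obtain ⟨S₁, hS₁, hrep⟩ := derives_prog hp G.prog x hx hκ (by omega) (hle.trans he) hLQ hsK hE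
      (fun y hy i => hb y hy i)
    have hκ' := hκ.trans (le_pow_mul hR1 C he0)
    have h2 : errGrowth T Q ^ C * e + roundErr r K T ≤ errGrowth T Q ^ (C + c + 1) * e := by
      calc _ ≤ 2 * (errGrowth T Q ^ C * e) := by linarith
        _ ≤ errGrowth T Q * (errGrowth T Q ^ C * e) := by gcongr
        _ = errGrowth T Q ^ (C + 1) * e := by ring
        _ ≤ _ := pow_mul_le_of_le hR1 (by omega) he0
    choose h hh hh' using fun j : Fin c => derives_sign hp (hrep (G.out j)) hκ'
      (h2.trans he) (fun y hy => hb y hy _) (β * ω 0 j)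
    refine ⟨h, (hS₁.comp (Derives.image Finset.univ h fun j _ => hh j)).mono subset_rfl
      (by simp) ?_, fun y hy j hj => hh' j y hy (h2.trans_lt hj)⟩
    rw [Finset.card_univ, Fintype.card_fin]
    nlinarith
  | @cons a b c G β E ih =>
    have he0 : 0 ≤ e := (roundErr_nonneg _ _ _).trans hκ
    set C := G.prog.cost fun _ g => g.preact.numParams with hC
    have hsize : (DeepLatentGaussian.cons G β E).size = C + b + 1 + E.size := rfl
    rw [hsize] at hT he ⊢
    obtain ⟨hE₁, hE₂⟩ := hE
    have hle : errGrowth T Q ^ C * e ≤ errGrowth T Q ^ (C + b + 1 + E.size) * e :=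
      pow_mul_le_of_le hR1 (by omega) he0
    obtain ⟨S₁, hS₁, hrep⟩ := derives_prog hp G.prog x hx hκ (by omega) (hle.trans he) hLQ hsK
      hE₁ (fun y hy i => (hb y hy).1 i)
    have hκ' := hκ.trans (le_pow_mul hR1 C he0)
    have h2 : errGrowth T Q ^ C * e + roundErr r K T ≤ errGrowth T Q ^ (C + b + 1) * e := by
      calc _ ≤ 2 * (errGrowth T Q ^ C * e) := by linarith
        _ ≤ errGrowth T Q * (errGrowth T Q ^ C * e) := by gcongr
        _ = errGrowth T Q ^ (C + 1) * e := by ring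
        _ ≤ _ := pow_mul_le_of_le hR1 (by omega) he0
    have h3 : errGrowth T Q ^ (C + b + 1) * e ≤ 1 :=
      (pow_mul_le_of_le hR1 (by omega) he0).trans he
    have hQ := hp.one_le_Q
    have hTQ : (0 : ℝ) ≤ T * Q := by positivity
    choose U hU hU' using fun j : Fin b => derives_add_const hp (hrep (G.out j))
      (he0.trans (le_pow_mul hR1 C he0)) (β * ω 0 j)
    have hS₂ := Derives.biUnion Finset.univ _ fun j _ => hU j
    have hmul : errGrowth T Q ^ E.size * (errGrowth T Q ^ (C + b + 1) * e) =
        errGrowth T Q ^ (C + b + 1 + E.size) * e := by rw [← mul_assoc, ← pow_add]; ring_nf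
    -- the input nodes of the next network are bounded, so the sums with the noise do not overflow
    have hrep₂ : ∀ j, Represented (⋃ j ∈ Finset.univ, Set.range (U j)) Y r K
        (errGrowth T Q ^ (C + b + 1) * e)
        (fun y => G.eval (fun i => x i y) j + β * ω 0 j) := fun j => by
      refine ⟨r + r, hp.bits_le, U j, fun i => by simp, fun y hy => (hU' j y hy ?_).trans h2⟩
      have h5 : |G.prog.wires Neuron.eval (fun i => x i y) (G.out j) + β * ω 0 j| ≤ Q :=
        (hb y hy).2.abs_input_le j
      nlinarith [hp.range]
    obtain ⟨h, hh, hh'⟩ := ih (fun i => ω (i + 1)) _ hrep₂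
      (hκ.trans (le_pow_mul hR1 (C + b + 1) he0)) (by omega) (by rw [hmul]; exact he) hE₂
      (fun y hy => (hb y hy).2)
    refine ⟨h, ((hS₁.comp hS₂).comp hh).mono subset_rfl subset_rfl ?_, fun y hy j hj => ?_⟩
    · rw [Finset.card_univ, Fintype.card_fin]
      nlinarith
    · exact hh' y hy j (by rw [hmul]; exact hj)

/-- With all noise hardwired (`ζ` for the generator, `ω` for the encoder), circuits compute the
signs of the output of an encoder on the input `y + ζ`, for bit strings `y` read as `±1`. -/
theorem exists_circuit_sign_sample (hp : AdequatePrecision r K T Q) (E : DeepLatentGaussian d d)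
    (ζ : Fin d → ℝ) (ω : ℕ → ℕ → ℝ) (hT : E.size ≤ T) {δ : ℝ}
    (hδ : errGrowth T Q ^ T * roundErr r K T < δ) (hδ1 : δ ≤ 1)
    {L : ℝ≥0} (hLQ : (L : ℝ) ≤ Q) {s : ℕ → ℕ} (hsK : s r ≤ K)
    (hE : E.AllNets fun _ _ N => N.prog.AllGates fun _ g => AdmissibleNeuron s L Q g) :
    ∃ C : BoolCircuit d d, C.size ≤ (d + T) * (nodeCost r K T + 1) + d ∧
      ∀ y : Fin d → Bool,
        E.NodesBoundedBy Q (fun j => (if y j then 1 else -1) + ζ j) ω →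
        (∀ j, δ ≤ |E.sample (fun j => (if y j then 1 else -1) + ζ j) ω j|) →
        C.eval y = fun j => decide (0 < E.sample (fun j => (if y j then 1 else -1) + ζ j) ω j) := by
  have hR : 1 ≤ errGrowth T Q := by linarith [two_le_errGrowth hp]
  have hκ := roundErr_nonneg r K T
  have hQ := hp.one_le_Q
  have hT1 := hp.one_le_T
  have hK : 1 ≤ K := by
    by_contra hK
    have hr : r = 0 := by have := hp.bits_le; omega
    have h1 := hp.range
    have : (0 : ℝ) ≤ T * Q := by positivity
    rw [hr, pow_zero] at h1
    nlinarith
  have hTK : 1 ≤ T * K := Nat.mul_pos hT1 hK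
  have hκ2 : (1 + 1) / 2 ^ r ≤ roundErr r K T := by
    unfold roundErr
    gcongr
    have : (1 : ℝ) ≤ T * K := by exact_mod_cast hTK
    linarith
  set Y : Set (Fin d → Bool) :=
    {y | E.NodesBoundedBy Q (fun j => (if y j then 1 else -1) + ζ j) ω} with hY
  choose U hU hU' using fun j : Fin d => derives_real_affine
    (S := Set.range fun (i : Fin d) x => x i) r {()} (fun _ x => x j) (fun _ _ => ⟨j, rfl⟩)
    (fun _ => 2) (-1 + ζ j)
  have hin := Derives.biUnion Finset.univ _ fun j _ => hU j
  have hκ1 : roundErr r K T ≤ 1 := ((le_pow_mul hR T hκ).trans hδ.le).trans hδ1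
  have hrep : ∀ j, Represented (⋃ j ∈ Finset.univ, Set.range (U j)) Y r K (roundErr r K T)
      (fun y => (if y j then 1 else -1) + ζ j) := fun j => by
    refine ⟨r + r, hp.bits_le, U j, fun i => by simp, fun y hy => ?_⟩
    have hx : ∑ _k ∈ {()}, (if y j then (2 : ℝ) else 0) + (-1 + ζ j) =
        (if y j then 1 else -1) + ζ j := by
      rw [Finset.sum_singleton]
      cases y j <;> simp
      ring
    have h1 := hU' j y
    rw [hx, Finset.card_singleton, Nat.cast_one] at h1
    refine (h1 ?_).trans hκ2
    have h2 := hy.abs_input_le j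
    have : (0 : ℝ) ≤ T * Q := by positivity
    nlinarith [hp.range]
  obtain ⟨h, hh, hh'⟩ := derives_sample hp E ω _ hrep le_rfl hT
    (((pow_mul_le_of_le hR hT hκ).trans hδ.le).trans hδ1) hLQ hsK hE fun y hy => hy
  obtain ⟨C, hC, hC'⟩ := Derives.exists_circuit subset_rfl (hin.comp hh) h fun i => ⟨i, rfl⟩
  refine ⟨C, hC.trans ?_, fun y hy hy' => funext fun j => ?_⟩
  · rw [Finset.card_univ, Fintype.card_fin, Finset.card_singleton, add_mul]
    gcongr
    unfold nodeCost
    nlinarith [Nat.mul_le_mul_right (200 * (r + 1)) hTK]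
  · rw [hC']
    exact hh' y hy j (((pow_mul_le_of_le hR hT hκ).trans_lt hδ).trans_le (hy' j))

end

/-! ### The generator network -/

/-- The signs of the coordinates of a real vector, as bits. -/
noncomputable def signBits {d : ℕ} (z : Fin d → ℝ) : Fin d → Bool := fun j => decide (0 < z j)

/-- The affine form `c * vᵢ`. -/
noncomputable def Affine.single {k : ℕ} (i : Fin k) (c : ℝ) : Affine k := ⟨Pi.single i c, 0⟩

theorem Affine.eval_single {k : ℕ} (i : Fin k) (c : ℝ) (v : Fin k → ℝ) :
    (Affine.single i c).eval v = c * v i := by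
  simp [Affine.eval, Affine.single, Pi.single_apply]

theorem Affine.numParams_single {k : ℕ} (i : Fin k) (c : ℝ) :
    (Affine.single i c).numParams ≤ 2 := by
  have : {j | (Affine.single i c).weight j ≠ 0} ⊆ {i} := by
    intro j hj
    by_contra h
    exact hj (Pi.single_eq_of_ne h _)
  have := Set.ncard_le_ncard this
  rw [Set.ncard_singleton] at this
  unfold Affine.numParams
  omega

/-- The signs of the first `k` inputs; `ψ` keeps track of the inputs and `φ` of the signs. -/
theorem exists_sgn_prog (d : ℕ) : ∀ k ≤ d, ∃ m, ∃ P : Prog SgnMinMaxGate d m,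
    ∃ φ ψ : Fin d → Fin m, P.cost SgnMinMaxGate.numParams ≤ 2 * k ∧
      ∀ z i, P.wires SgnMinMaxGate.eval z (ψ i) = z i ∧
        ((i : ℕ) < k → P.wires SgnMinMaxGate.eval z (φ i) = Real.sign (z i)) := by
  intro k
  induction k with
  | zero => exact fun _ => ⟨d, .nil, id, id, le_rfl, fun z i => ⟨rfl, fun h => absurd h (by simp)⟩⟩
  | succ k ih =>
    intro hk
    obtain ⟨m, P, φ, ψ, hc, h⟩ := ih (by omega)
    refine ⟨m + 1, P.snoc (.sgn (.single (ψ ⟨k, hk⟩) 1)),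
      Function.update (fun i => (φ i).castSucc) ⟨k, hk⟩ (Fin.last m), fun i => (ψ i).castSucc,
      ?_, fun z i => ⟨?_, fun hi => ?_⟩⟩
    · have := Affine.numParams_single (ψ ⟨k, hk⟩) 1
      simp only [Prog.cost, SgnMinMaxGate.numParams]
      omega
    · simpa [Prog.wires] using (h z i).1
    · rcases eq_or_ne i ⟨k, hk⟩ with rfl | hne
      · simp [Prog.wires, SgnMinMaxGate.eval, Affine.eval_single, (h z _).1]
      · have : (i : ℕ) ≠ k := fun h => hne (Fin.ext h)
        simpa [Prog.wires, hne] using (h z i).2 (by omega)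

/-- Boolean gates on `±1` are `min`, `max` and negation. -/
theorem exists_sgnMinMax_prog {d m : ℕ} (P : Prog BoolGate d m) :
    ∃ m', ∃ P' : Prog SgnMinMaxGate d m', ∃ φ : Fin m → Fin m',
      P'.cost SgnMinMaxGate.numParams ≤ 2 * d + 4 * P.cost (fun _ _ => 1) ∧
      ∀ z : Fin d → ℝ, (∀ i, z i ≠ 0) → ∀ i, P'.wires SgnMinMaxGate.eval z (φ i) =
        if P.wires BoolGate.eval (signBits z) i then 1 else -1 := by
  induction P with
  | nil =>
    obtain ⟨m, P, φ, ψ, hc, h⟩ := exists_sgn_prog d d le_rfl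
    refine ⟨m, P, φ, by omega, fun z hz i => ?_⟩
    rw [(h z i).2 i.2]
    rcases lt_or_gt_of_ne (hz i) with h | h
    · simp [Prog.wires, signBits, Real.sign_of_neg h, h.le]
    · simp [Prog.wires, signBits, Real.sign_of_pos h, h]
  | @snoc m P g ih =>
    obtain ⟨m', P', φ, hc, h⟩ := ih
    have key : ∃ g' : SgnMinMaxGate m', g'.numParams ≤ 4 ∧ ∀ z : Fin d → ℝ, (∀ i, z i ≠ 0) →
        g'.eval m' (P'.wires SgnMinMaxGate.eval z) =
          if g.eval m (P.wires BoolGate.eval (signBits z)) then 1 else -1 := by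
      have h2 : ∀ (i j : Fin m') (c c' : ℝ),
          (Affine.single i c).numParams + (Affine.single j c').numParams ≤ 4 := fun i j c c' => by
        have := Affine.numParams_single i c
        have := Affine.numParams_single j c'
        omega
      cases g with
      | const b =>
        refine ⟨.max ⟨0, if b then 1 else -1⟩ ⟨0, if b then 1 else -1⟩, ?_, fun z _ => ?_⟩
        · simp [SgnMinMaxGate.numParams, Affine.numParams]
        · cases b <;> simp [SgnMinMaxGate.eval, Affine.eval, BoolGate.eval]
      | not i =>
        refine ⟨.max (.single (φ i) (-1)) (.single (φ i) (-1)), h2 _ _ _ _, fun z hz => ?_⟩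
        simp only [SgnMinMaxGate.eval, Affine.eval_single, h z hz, BoolGate.eval]
        by_cases hi : P.wires BoolGate.eval (signBits z) i = true <;> simp [hi]
      | and i j =>
        refine ⟨.min (.single (φ i) 1) (.single (φ j) 1), h2 _ _ _ _, fun z hz => ?_⟩
        simp only [SgnMinMaxGate.eval, Affine.eval_single, h z hz, BoolGate.eval]
        by_cases hi : P.wires BoolGate.eval (signBits z) i = true <;>
          by_cases hj : P.wires BoolGate.eval (signBits z) j = true <;> simp [hi, hj]
      | or i j =>
        refine ⟨.max (.single (φ i) 1) (.single (φ j) 1), h2 _ _ _ _, fun z hz => ?_⟩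
        simp only [SgnMinMaxGate.eval, Affine.eval_single, h z hz, BoolGate.eval]
        by_cases hi : P.wires BoolGate.eval (signBits z) i = true <;>
          by_cases hj : P.wires BoolGate.eval (signBits z) j = true <;> simp [hi, hj]
    obtain ⟨g', hg', hg'eval⟩ := key
    refine ⟨m' + 1, P'.snoc g', Fin.snoc (fun i => (φ i).castSucc) (Fin.last m'), ?_,
      fun z hz i => ?_⟩
    · simp only [Prog.cost]
      omega
    · induction i using Fin.lastCases with
      | last => simpa [Prog.wires] using hg'eval z hz
      | cast i => simpa [Prog.wires] using h z hz i

theorem BoolCircuit.exists_sgnMinMaxNet {d : ℕ} (C : BoolCircuit d d) :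
    ∃ G : SgnMinMaxNet d d, G.size ≤ 2 * d + 4 * C.size ∧ ∀ z : Fin d → ℝ, (∀ i, z i ≠ 0) →
      G.eval z = fun i => if C.eval (signBits z) i then 1 else -1 := by
  obtain ⟨m, P, φ, hc, h⟩ := exists_sgnMinMax_prog C.prog
  refine ⟨⟨m, P, fun i => φ (C.out i)⟩, ?_, fun z hz => funext fun i => h z hz _⟩
  simp only [SgnMinMaxNet.size, BoolCircuit.size]
  omega

/-! ### Measurability -/

theorem Prog.measurable_wires {Γ : ℕ → Type} {n m : ℕ} {ev : ∀ k, Γ k → (Fin k → ℝ) → ℝ}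
    {P : Prog Γ n m} (hP : P.AllGates fun k g => Measurable (ev k g)) :
    Measurable (P.wires ev) := by
  induction P with
  | nil => exact measurable_id
  | snoc P g ih =>
    refine measurable_pi_lambda _ fun i => ?_
    induction i using Fin.lastCases with
    | last => simpa [Prog.wires, Function.comp_def] using hP.2.comp (ih hP.1)
    | cast i =>
      simpa [Prog.wires, Function.comp_def] using (measurable_pi_apply i).comp (ih hP.1)

theorem Affine.measurable_eval {k : ℕ} (a : Affine k) : Measurable a.eval := by
  unfold Affine.eval
  fun_prop

theorem SgnMinMaxNet.measurable_eval {n k : ℕ} (N : SgnMinMaxNet n k) : Measurable N.eval := by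
  have hsign : Measurable Real.sign := by
    unfold Real.sign
    exact Measurable.ite measurableSet_Iio measurable_const
      (Measurable.ite measurableSet_Ioi measurable_const measurable_const)
  have : N.prog.AllGates fun k g => Measurable (SgnMinMaxGate.eval k g) := by
    have h : ∀ k (g : SgnMinMaxGate k), Measurable (SgnMinMaxGate.eval k g) := by
      rintro k (a | ⟨a, b⟩ | ⟨a, b⟩)
      · exact hsign.comp a.measurable_eval
      · exact a.measurable_eval.min b.measurable_eval
      · exact a.measurable_eval.max b.measurable_eval
    obtain ⟨m, P, o⟩ := N
    change P.AllGates _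
    clear o
    induction P with
    | nil => trivial
    | snoc P g ih => exact ⟨ih, h _ g⟩
  exact measurable_pi_lambda _ fun i => (measurable_pi_apply _).comp (Prog.measurable_wires this)

namespace DeepLatentGaussian

/-- The nodes of all networks depend measurably on their inputs. -/
def MeasurableNodes {a c : ℕ} (E : DeepLatentGaussian a c) : Prop :=
  E.AllNets fun _ _ N => Measurable N.nodes

theorem measurable_layer {a b : ℕ} {G : NeuralNet a b} (hG : Measurable G.nodes) (β : ℝ) :
    Measurable fun p : (Fin a → ℝ) × (ℕ → ℕ → ℝ) => fun j => G.eval p.1 j + β * p.2 0 j := by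
  refine measurable_pi_lambda _ fun j => ?_
  have h1 : Measurable fun p : (Fin a → ℝ) × (ℕ → ℕ → ℝ) => G.eval p.1 j :=
    ((measurable_pi_apply _).comp hG).comp measurable_fst
  fun_prop

theorem measurable_next {a b : ℕ} {G : NeuralNet a b} (hG : Measurable G.nodes) (β : ℝ) :
    Measurable fun p : (Fin a → ℝ) × (ℕ → ℕ → ℝ) =>
      ((fun j => G.eval p.1 j + β * p.2 0 j : Fin b → ℝ), fun i => p.2 (i + 1)) :=
  (measurable_layer hG β).prodMk (measurable_pi_lambda _ fun i => by fun_prop)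

theorem measurable_sample {a c : ℕ} {E : DeepLatentGaussian a c} (hE : E.MeasurableNodes) :
    Measurable fun p : (Fin a → ℝ) × (ℕ → ℕ → ℝ) => E.sample p.1 p.2 := by
  induction E with
  | single G β => exact measurable_layer hE β
  | cons G β E ih => exact (ih hE.2).comp (measurable_next hE.1 β)

theorem measurableSet_nodesBoundedBy {a c : ℕ} {E : DeepLatentGaussian a c}
    (hE : E.MeasurableNodes) (M : ℝ) :
    MeasurableSet {p : (Fin a → ℝ) × (ℕ → ℕ → ℝ) | E.NodesBoundedBy M p.1 p.2} := by
  have hnodes : ∀ {a b : ℕ} {G : NeuralNet a b}, Measurable G.nodes →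
      MeasurableSet {p : (Fin a → ℝ) × (ℕ → ℕ → ℝ) | ∀ i, |G.nodes p.1 i| ≤ M} := by
    intro a b G hG
    simp only [Set.ofPred_forall]
    refine MeasurableSet.iInter fun i => measurableSet_le ?_ measurable_const
    exact ((measurable_pi_apply i).comp (hG.comp measurable_fst)).abs
  induction E with
  | single G β => exact hnodes hE
  | cons G β E ih => exact (hnodes hE.1).inter (measurable_next hE.1 β (ih hE.2))

end DeepLatentGaussian

theorem measurable_signBits {d : ℕ} : Measurable (signBits : (Fin d → ℝ) → Fin d → Bool) := by
  refine measurable_pi_lambda _ fun j => ?_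
  refine measurable_to_bool ?_
  have : (fun z : Fin d → ℝ => signBits z j) ⁻¹' {true} = {z | 0 < z j} := by
    ext z; simp [signBits]
  rw [this]
  exact measurableSet_lt measurable_const (measurable_pi_apply j)

/-! ### Gaussian estimates -/

theorem gaussianReal_Iio_zero : gaussianReal 0 1 (Set.Iio 0) = gaussianReal 0 1 (Set.Ioi 0) := by
  have h := gaussianReal_map_neg (μ := 0) (v := 1)
  rw [neg_zero] at h
  conv_lhs => rw [← h]
  rw [Measure.map_apply measurable_neg measurableSet_Iio]
  congr 1
  ext x
  simp

theorem gaussianReal_sign (b : Bool) :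
    gaussianReal 0 1 {t | decide (0 < t) = b} = 2⁻¹ := by
  have : NullSingletonClass (gaussianReal 0 1) := nullSingletonClass_gaussianReal one_ne_zero
  have h0 : gaussianReal 0 1 (Set.Iic 0) = gaussianReal 0 1 (Set.Ioi 0) := by
    rw [← gaussianReal_Iio_zero]
    exact measure_congr Iio_ae_eq_Iic.symm
  have h1 : gaussianReal 0 1 (Set.Iic 0) + gaussianReal 0 1 (Set.Ioi 0) = 1 := by
    rw [← Set.compl_Iic, measure_add_measure_compl measurableSet_Iic, measure_univ]
  have h2 : gaussianReal 0 1 (Set.Ioi 0) = 2⁻¹ := by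
    rw [h0, ← two_mul] at h1
    exact ENNReal.eq_inv_of_mul_eq_one_left (by rwa [mul_comm])
  cases b
  · have : {t : ℝ | decide (0 < t) = false} = Set.Iic 0 := by ext; simp
    rw [this, h0, h2]
  · have : {t : ℝ | decide (0 < t) = true} = Set.Ioi 0 := by ext; simp
    rw [this, h2]

/-- The signs of a standard Gaussian vector are uniformly distributed. -/
theorem stdNormal_signBits_le {d : ℕ} (B : Set (Fin d → Bool)) :
    stdNormal d {z | signBits z ∈ B} ≤ B.ncard * (2⁻¹ : ℝ≥0∞) ^ d := by
  have hpt : ∀ b : Fin d → Bool, stdNormal d {z | signBits z = b} = 2⁻¹ ^ d := by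
    intro b
    have : {z : Fin d → ℝ | signBits z = b} = Set.univ.pi fun j => {t | decide (0 < t) = b j} := by
      ext z
      simp [signBits, funext_iff]
    rw [this, stdNormal, Measure.pi_pi]
    simp [gaussianReal_sign]
  have : {z : Fin d → ℝ | signBits z ∈ B} = ⋃ b ∈ B.toFinite.toFinset, {z | signBits z = b} := by
    ext z; simp
  rw [this]
  refine (measure_biUnion_finset_le _ _).trans ?_
  simp_rw [hpt]
  rw [Finset.sum_const, nsmul_eq_mul, Set.ncard_eq_toFinset_card _ B.toFinite]

theorem gaussianReal_abs_lt {δ : ℝ} (hδ : 0 ≤ δ) :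
    (gaussianReal 0 1).real {t | |t| < δ} ≤ δ := by
  have hset : {t : ℝ | |t| < δ} = Set.Ioo (-δ) δ := by ext; simp [abs_lt]
  have hpdf : ∀ x, gaussianPDF 0 1 x ≤ ENNReal.ofReal 2⁻¹ := by
    intro x
    refine ENNReal.ofReal_le_ofReal ?_
    rw [gaussianPDFReal]
    have h1 : (2 : ℝ) ≤ √(2 * Real.pi * (1 : ℝ≥0)) := by
      have := Real.pi_gt_three
      refine Real.le_sqrt_of_sq_le ?_
      norm_num
      linarith
    have h2 : Real.exp (-(x - 0) ^ 2 / (2 * (1 : ℝ≥0))) ≤ 1 := by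
      rw [Real.exp_le_one_iff]
      have : 0 ≤ (x - 0) ^ 2 := sq_nonneg _
      norm_num
      nlinarith
    calc _ ≤ (√(2 * Real.pi * (1 : ℝ≥0)))⁻¹ * 1 := by gcongr
      _ ≤ 2⁻¹ := by rw [mul_one]; gcongr
  rw [hset, measureReal_def]
  refine ENNReal.toReal_le_of_le_ofReal hδ ?_
  rw [gaussianReal_apply 0 one_ne_zero]
  refine (lintegral_mono hpdf).trans ?_
  rw [setLIntegral_const, Real.volume_Ioo, ← ENNReal.ofReal_mul (by norm_num)]
  apply ENNReal.ofReal_le_ofReal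
  linarith

theorem gaussianReal_le_abs {t : ℝ} (ht : 0 ≤ t) :
    (gaussianReal 0 1).real {x | t ≤ |x|} ≤ 2 * Real.exp (-t ^ 2 / 2) := by
  have key : ∀ X : ℝ → ℝ, (gaussianReal 0 1).map X = gaussianReal 0 1 →
      (∀ s, Integrable (fun x => Real.exp (s * X x)) (gaussianReal 0 1)) →
      (gaussianReal 0 1).real {x | t ≤ X x} ≤ Real.exp (-t ^ 2 / 2) := by
    intro X hX hint
    refine (measure_ge_le_exp_mul_mgf t ht (hint t)).trans ?_
    rw [mgf_gaussianReal hX, ← Real.exp_add]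
    apply le_of_eq
    congr 1
    simp
    ring
  have h1 := key id Measure.map_id fun s => integrable_exp_mul_gaussianReal s
  have h2 := key (fun x => -x) (by rw [gaussianReal_map_neg, neg_zero]) fun s => by
    simpa using integrable_exp_mul_gaussianReal (μ := 0) (v := 1) (-s)
  have : {x : ℝ | t ≤ |x|} ⊆ {x | t ≤ id x} ∪ {x | t ≤ -x} :=
    fun x (hx : t ≤ |x|) => le_abs.1 hx
  refine (measureReal_mono this).trans ((measureReal_union_le _ _).trans ?_)
  linarith

theorem stdNormal_exists_le {d : ℕ} {A : Set ℝ} (hA : MeasurableSet A) {c : ℝ}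
    (h : (gaussianReal 0 1).real A ≤ c) : (stdNormal d).real {z | ∃ j, z j ∈ A} ≤ d * c := by
  have hset : {z : Fin d → ℝ | ∃ j, z j ∈ A} = ⋃ j : Fin d, (fun z => z j) ⁻¹' A := by ext; simp
  rw [hset]
  refine (measureReal_iUnion_fintype_le _).trans
    ((Finset.sum_le_card_nsmul _ _ c fun j _ => ?_).trans (by simp))
  have hmp : (stdNormal d).map (fun z => z j) = gaussianReal 0 1 :=
    (measurePreserving_eval (fun _ : Fin d => gaussianReal 0 1) j).map_eq
  rwa [← map_measureReal_apply (measurable_pi_apply j) hA, hmp]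

/-- The exceptional latent vectors and noise vectors: a coordinate of `z` is close to zero, or the
noise is large enough to change a sign. -/
def Exceptional (d : ℕ) (β δ : ℝ) : Set ((Fin d → ℝ) × (Fin d → ℝ)) :=
  {p | (∃ j, |p.1 j| < δ) ∨ ∃ j, 1 ≤ |β * p.2 j|}

theorem measurableSet_exceptional (d : ℕ) (β δ : ℝ) : MeasurableSet (Exceptional d β δ) := by
  unfold Exceptional
  simp only [Set.ofPred_or, Set.ofPred_exists]
  refine MeasurableSet.union (MeasurableSet.iUnion fun j => measurableSet_lt ?_ ?_)
    (MeasurableSet.iUnion fun j => measurableSet_le ?_ ?_) <;> fun_prop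

theorem measure_exceptional_le {d : ℕ} {β δ : ℝ} (hβ : 0 < β) (hβd : 2 * √d * β ≤ 1) (hδ : 0 ≤ δ) :
    ((stdNormal d).prod (stdNormal d)).real (Exceptional d β δ) ≤
      d * δ + d * (2 * Real.exp (-(2 * d))) := by
  have h1 : (stdNormal d).real {z | ∃ j, z j ∈ {t : ℝ | |t| < δ}} ≤ d * δ :=
    stdNormal_exists_le (measurableSet_lt (by fun_prop) (by fun_prop)) (gaussianReal_abs_lt hδ)
  have h2 : (stdNormal d).real {z | ∃ j, z j ∈ {t : ℝ | 2 * √d ≤ |t|}} ≤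
      d * (2 * Real.exp (-(2 * d))) := by
    refine stdNormal_exists_le (measurableSet_le (by fun_prop) (by fun_prop))
      ((gaussianReal_le_abs (by positivity)).trans (le_of_eq ?_))
    rw [mul_pow, Real.sq_sqrt (Nat.cast_nonneg d)]
    congr 2
    ring
  have hsub : Exceptional d β δ ⊆ {z | ∃ j, z j ∈ {t : ℝ | |t| < δ}} ×ˢ Set.univ ∪
      Set.univ ×ˢ {z | ∃ j, z j ∈ {t : ℝ | 2 * √d ≤ |t|}} := by
    rintro ⟨z, ζ⟩ (⟨j, hj⟩ | ⟨j, hj⟩)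
    · exact Or.inl ⟨⟨j, hj⟩, trivial⟩
    · refine Or.inr ⟨trivial, j, ?_⟩
      change 1 ≤ |β * ζ j| at hj
      change 2 * √d ≤ |ζ j|
      rw [abs_mul, abs_of_pos hβ] at hj
      by_contra hlt
      nlinarith
  refine (measureReal_mono hsub).trans ((measureReal_union_le _ _).trans ?_)
  rw [measureReal_prod_prod, measureReal_prod_prod, probReal_univ]
  linarith

/-! ### From an approximation of the posterior to an inverter with fixed noise -/

section

variable {d : ℕ} {g : (Fin d → ℝ) → (Fin d → ℝ)}

theorem measurable_add_noise (hg : Measurable g) (β : ℝ) :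
    Measurable fun p : (Fin d → ℝ) × (Fin d → ℝ) => g p.1 + β • p.2 := by
  exact (hg.comp measurable_fst).add (measurable_snd.const_smul β)

/-- The joint law of latent vector and observation is that of `(z, g z + β ζ)` for independent
standard Gaussian vectors `z` and `ζ`. -/
theorem compProd_latentGaussian (hg : Measurable g) (β : ℝ) :
    stdNormal d ⊗ₘ latentGaussian g β =
      ((stdNormal d).prod (stdNormal d)).map fun p => (p.1, g p.1 + β • p.2) := by
  have hm := measurable_add_noise hg β
  ext s hs
  rw [Measure.compProd_apply hs, Measure.map_apply (measurable_fst.prodMk hm) hs,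
    Measure.prod_apply (measurable_fst.prodMk hm hs)]
  refine lintegral_congr fun z => ?_
  rw [latentGaussian, Kernel.map_apply' _ hm _ (measurable_prodMk_left hs), Kernel.prod_apply,
    Kernel.id_apply, Kernel.const_apply, Measure.dirac_prod,
    Measure.map_apply measurable_prodMk_left (hm (measurable_prodMk_left hs))]
  rfl

theorem sampleLaw_eq_map (hg : Measurable g) (β : ℝ) :
    sampleLaw g β = ((stdNormal d).prod (stdNormal d)).map fun p => g p.1 + β • p.2 := by
  have hm := measurable_add_noise hg β
  rw [sampleLaw, ← Measure.snd_compProd, compProd_latentGaussian hg, Measure.snd,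
    Measure.map_map measurable_snd (measurable_fst.prodMk hm)]
  rfl

theorem isProbabilityMeasure_sampleLaw (hg : Measurable g) (β : ℝ) :
    IsProbabilityMeasure (sampleLaw g β) := by
  rw [sampleLaw_eq_map hg]
  exact Measure.isProbabilityMeasure_map (measurable_add_noise hg β).aemeasurable

theorem compProd_posteriorLaw (hg : Measurable g) (β : ℝ) :
    sampleLaw g β ⊗ₘ posteriorLaw g β =
      ((stdNormal d).prod (stdNormal d)).map fun p => (g p.1 + β • p.2, p.1) := by
  have hm := measurable_add_noise hg β
  rw [sampleLaw, posteriorLaw, compProd_posterior_eq_map_swap, compProd_latentGaussian hg,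
    Measure.map_map measurable_swap (measurable_fst.prodMk hm)]
  rfl

/-- The pairs `(x, z)` where `z` solves the inversion problem posed by the signs of `x`, and has no
coordinate close to zero. -/
def Inverts (f : (Fin d → Bool) → (Fin d → Bool)) (δ : ℝ) : Set ((Fin d → ℝ) × (Fin d → ℝ)) :=
  {p | (∀ j, δ ≤ |p.2 j|) ∧ f (signBits p.2) = signBits p.1}

theorem measurableSet_inverts (f : (Fin d → Bool) → (Fin d → Bool)) (δ : ℝ) :
    MeasurableSet (Inverts f δ) := by
  refine MeasurableSet.inter (s₁ := {p : (Fin d → ℝ) × (Fin d → ℝ) | ∀ j, δ ≤ |p.2 j|}) ?_ ?_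
  · simp only [Set.ofPred_forall]
    exact MeasurableSet.iInter fun j => measurableSet_le (by fun_prop) (by fun_prop)
  · exact measurableSet_eq_fun ((measurable_of_finite f).comp (measurable_signBits.comp
      measurable_snd)) (measurable_signBits.comp measurable_fst)

theorem signBits_sign_add {b : Fin d → Bool} {ζ : Fin d → ℝ} (hζ : ∀ j, |ζ j| < 1) :
    signBits (fun j => (if b j then 1 else -1) + ζ j) = b := by
  funext j
  have := abs_lt.1 (hζ j)
  unfold signBits
  cases hb : b j
  · simp only [hb, decide_eq_false_iff_not, not_lt, Bool.false_eq_true, if_false]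
    linarith
  · simp only [hb, decide_eq_true_eq, if_true]
    linarith

/-- If the encoder is close to the posterior with probability more than `ε`, then the noise of the
generator and of the encoder can be fixed in such a way that the signs of the output of the encoder
still invert `f` on a large fraction of the inputs. -/
theorem exists_noise {f : (Fin d → Bool) → (Fin d → Bool)} (hf : Function.Injective f)
    (hg : Measurable g) (hgf : ∀ z : Fin d → ℝ, (∀ i, z i ≠ 0) →
      g z = fun i => if f (signBits z) i then 1 else -1)
    {β δ η ε τ M c : ℝ} (hδ : 0 < δ)
    (hη : ((stdNormal d).prod (stdNormal d)).real (Exceptional d β δ) ≤ η)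
    (E : DeepLatentGaussian d d) (hE : E.MeasurableNodes)
    (hM : 1 - τ ≤ ((sampleLaw g β).prod noiseLaw).real {p | E.NodesBoundedBy M p.1 p.2})
    (hε : ε < (sampleLaw g β).real {x | tvDist (E.law x) (posteriorLaw g β x) ≤ 1 / 10})
    (hc : c ≤ 8 / 10 * (ε - 10 * η) - τ - η) :
    ∃ (ζ : Fin d → ℝ) (ω : ℕ → ℕ → ℝ), c <
      ({b | E.NodesBoundedBy M (fun j => (if f b j then 1 else -1) + β * ζ j) ω ∧
        (∀ j, δ ≤ |E.sample (fun j => (if f b j then 1 else -1) + β * ζ j) ω j|) ∧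
        signBits (E.sample (fun j => (if f b j then 1 else -1) + β * ζ j) ω) = b}.ncard : ℝ)
      / 2 ^ d := by
  set ν := stdNormal d with hν
  set μ := sampleLaw g β with hμ
  set R := Inverts f δ with hR
  have hRm : MeasurableSet R := measurableSet_inverts f δ
  have hprob : IsProbabilityMeasure μ := isProbabilityMeasure_sampleLaw hg β
  have hnoise : IsProbabilityMeasure noiseLaw := by unfold noiseLaw; infer_instance
  have hX := measurable_add_noise hg β
  have hmarkov : IsMarkovKernel (posteriorLaw g β) := by unfold posteriorLaw; infer_instance
  have hNm := measurableSet_exceptional d β δ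
  have hs := E.measurable_sample hE
  have hη0 : 0 ≤ η := measureReal_nonneg.trans hη
  -- outside the exceptional set, the latent vector inverts the signs of the observation
  have hgood : ∀ p ∉ Exceptional d β δ, g p.1 + β • p.2 =
      (fun j => (if f (signBits p.1) j then 1 else -1) + β * p.2 j) ∧
      signBits (g p.1 + β • p.2) = f (signBits p.1) := by
    intro p hp
    simp only [Exceptional, Set.mem_ofPred_eq, not_or, not_exists, not_lt, not_le] at hp
    have hx : g p.1 + β • p.2 = fun j => (if f (signBits p.1) j then 1 else -1) + β * p.2 j := by
      funext j
      rw [hgf p.1 fun i => abs_pos.1 (hδ.trans_le (hp.1 i))]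
      simp
    exact ⟨hx, by rw [hx]; exact signBits_sign_add hp.2⟩
  have hRc : (μ ⊗ₘ posteriorLaw g β) Rᶜ ≤ ENNReal.ofReal η := by
    rw [hμ, compProd_posteriorLaw hg, Measure.map_apply (hX.prodMk measurable_fst) hRm.compl]
    refine (measure_mono (t := Exceptional d β δ) fun p hp => ?_).trans
      ((ENNReal.le_ofReal_iff_toReal_le (measure_ne_top _ _) hη0).2 hη)
    by_contra hn
    refine hp ⟨?_, (hgood p hn).2.symm⟩
    simp only [Exceptional, Set.mem_ofPred_eq, not_or, not_exists, not_lt, not_le] at hn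
    exact hn.1
  -- by Markov's inequality, the posterior is concentrated on the solution for most `x`
  set B : Set (Fin d → ℝ) := {x | ENNReal.ofReal (1 / 10) ≤ posteriorLaw g β x (Prod.mk x ⁻¹' Rᶜ)}
    with hB
  have hBle : μ.real B ≤ 10 * η := by
    have h1 : μ B ≤ (∫⁻ x, posteriorLaw g β x (Prod.mk x ⁻¹' Rᶜ) ∂μ) / ENNReal.ofReal (1 / 10) :=
      meas_ge_le_lintegral_div (Kernel.measurable_kernel_prodMk_left hRm.compl).aemeasurable
        (by simp) (by simp)
    rw [← Measure.compProd_apply hRm.compl] at h1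
    have h2 : μ B ≤ ENNReal.ofReal (10 * η) := by
      refine h1.trans ((ENNReal.div_le_div_right hRc _).trans ?_)
      rw [← ENNReal.ofReal_div_of_pos (by norm_num)]
      apply ENNReal.ofReal_le_ofReal
      linarith
    exact ENNReal.toReal_le_of_le_ofReal (by positivity) h2
  set R' : Set ((Fin d → ℝ) × (ℕ → ℕ → ℝ)) := {p | (p.1, E.sample p.1 p.2) ∈ R} with hR'
  have hR'm : MeasurableSet R' := (measurable_fst.prodMk hs) hRm
  have hlaw : ∀ x, Measurable (E.sample x) := fun x => hs.comp measurable_prodMk_left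
  set A : Set (Fin d → ℝ) := {x | ENNReal.ofReal (8 / 10) ≤ noiseLaw (Prod.mk x ⁻¹' R')} with hA
  have hAS : {x | tvDist (E.law x) (posteriorLaw g β x) ≤ 1 / 10} ⊆ B ∪ A := by
    intro x hx
    by_contra hn
    rw [Set.mem_union, not_or] at hn
    obtain ⟨hnB, hnA⟩ := hn
    apply hnA
    have hRx : MeasurableSet (Prod.mk x ⁻¹' R) := measurable_prodMk_left hRm
    have hElaw : IsProbabilityMeasure (E.law x) :=
      Measure.isProbabilityMeasure_map (hlaw x).aemeasurable
    have hpost : 9 / 10 ≤ (posteriorLaw g β x).real (Prod.mk x ⁻¹' R) := by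
      have h1 := probReal_compl_eq_one_sub (μ := posteriorLaw g β x) hRx
      have h2 : (posteriorLaw g β x).real (Prod.mk x ⁻¹' R)ᶜ ≤ 1 / 10 :=
        ENNReal.toReal_le_of_le_ofReal (by norm_num) (not_le.1 hnB).le
      linarith
    have htv : |(E.law x).real (Prod.mk x ⁻¹' R) -
        (posteriorLaw g β x).real (Prod.mk x ⁻¹' R)| ≤ 1 / 10 := by
      refine le_trans ?_ hx
      refine le_ciSup (f := fun A : {A : Set (Fin d → ℝ) // MeasurableSet A} =>
        |(E.law x).real A.1 - (posteriorLaw g β x).real A.1|) ⟨1, ?_⟩ ⟨_, hRx⟩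
      rintro _ ⟨A, rfl⟩
      have h1 := measureReal_le_one (μ := E.law x) (s := A.1)
      have h2 := measureReal_le_one (μ := posteriorLaw g β x) (s := A.1)
      have h3 := measureReal_nonneg (μ := E.law x) (s := A.1)
      have h4 := measureReal_nonneg (μ := posteriorLaw g β x) (s := A.1)
      exact abs_le.2 ⟨by linarith, by linarith⟩
    have hE' : 8 / 10 ≤ (E.law x).real (Prod.mk x ⁻¹' R) := by
      have := abs_le.1 htv
      linarith
    have : E.law x (Prod.mk x ⁻¹' R) = noiseLaw (Prod.mk x ⁻¹' R') := by
      rw [DeepLatentGaussian.law, Measure.map_apply (hlaw x) hRx]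
      rfl
    change _ ≤ noiseLaw (Prod.mk x ⁻¹' R')
    rw [← this]
    exact ENNReal.ofReal_le_of_le_toReal hE'
  have hAε : ε - 10 * η < μ.real A := by
    have := (measureReal_mono (μ := μ) hAS).trans (measureReal_union_le _ _)
    linarith
  have hR'ge : 8 / 10 * μ.real A ≤ (μ.prod noiseLaw).real R' := by
    have h1 := mul_meas_ge_le_lintegral₀ (μ := μ)
      (measurable_measure_prodMk_left (ν := noiseLaw) hR'm).aemeasurable (ENNReal.ofReal (8 / 10))
    rw [← Measure.prod_apply hR'm] at h1
    have h2 := ENNReal.toReal_mono (measure_ne_top _ _) h1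
    rwa [ENNReal.toReal_mul, ENNReal.toReal_ofReal (by norm_num)] at h2
  -- all the randomness: the latent vector, and the noise that will be fixed
  set P := ν.prod (ν.prod noiseLaw) with hP
  let F : (Fin d → ℝ) × ((Fin d → ℝ) × (ℕ → ℕ → ℝ)) → (Fin d → ℝ) × (ℕ → ℕ → ℝ) :=
    fun p => (g p.1 + β • p.2.1, p.2.2)
  have hFm : Measurable F :=
    (hX.comp (measurable_fst.prodMk (measurable_fst.comp measurable_snd))).prodMk
      (measurable_snd.comp measurable_snd)
  have hFmap : P.map F = μ.prod noiseLaw := by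
    have h1 : P = ((ν.prod ν).prod noiseLaw).map MeasurableEquiv.prodAssoc :=
      (measurePreserving_prodAssoc ν ν noiseLaw).map_eq.symm
    rw [h1, Measure.map_map hFm MeasurableEquiv.prodAssoc.measurable, hμ, sampleLaw_eq_map hg]
    conv_rhs => rw [← Measure.map_id (μ := noiseLaw)]
    rw [Measure.map_prod_map _ _ hX measurable_id]
    rfl
  set NB : Set ((Fin d → ℝ) × (ℕ → ℕ → ℝ)) := {p | E.NodesBoundedBy M p.1 p.2} with hNB
  have hNBm : MeasurableSet NB := E.measurableSet_nodesBoundedBy hE M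
  let π : (Fin d → ℝ) × ((Fin d → ℝ) × (ℕ → ℕ → ℝ)) → (Fin d → ℝ) × (Fin d → ℝ) :=
    fun p => (p.1, p.2.1)
  have hπm : Measurable π := measurable_fst.prodMk (measurable_fst.comp measurable_snd)
  have hπmap : P.map π = ν.prod ν := by
    have h1 : P.map (Prod.map id Prod.fst) = (ν.map id).prod ((ν.prod noiseLaw).map Prod.fst) :=
      (Measure.map_prod_map _ _ measurable_id measurable_fst).symm
    rw [Measure.map_id, ← Measure.fst, Measure.fst_prod] at h1
    exact h1
  set G' := F ⁻¹' (R' ∩ NB) \ π ⁻¹' (Exceptional d β δ) with hG'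
  have hG'm : MeasurableSet G' := (hFm (hR'm.inter hNBm)).diff (hπm hNm)
  have hG'ge : c < P.real G' := by
    have h1 : P.real (F ⁻¹' R') = (μ.prod noiseLaw).real R' := by
      rw [← hFmap, map_measureReal_apply hFm hR'm]
    have h2 : P.real (F ⁻¹' NBᶜ) = 1 - (μ.prod noiseLaw).real NB := by
      rw [← probReal_compl_eq_one_sub hNBm, ← hFmap, map_measureReal_apply hFm hNBm.compl]
    have h3 : P.real (π ⁻¹' Exceptional d β δ) = (ν.prod ν).real (Exceptional d β δ) := by
      rw [← hπmap, map_measureReal_apply hπm hNm]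
    have h4 : F ⁻¹' R' ⊆ G' ∪ F ⁻¹' NBᶜ ∪ π ⁻¹' Exceptional d β δ := by
      intro p hp
      by_cases hp1 : F p ∈ NB
      · by_cases hp2 : π p ∈ Exceptional d β δ
        · exact Or.inr hp2
        · exact Or.inl (Or.inl ⟨⟨hp, hp1⟩, hp2⟩)
      · exact Or.inl (Or.inr hp1)
    have h5 := (measureReal_mono (μ := P) h4).trans ((measureReal_union_le _ _).trans
      (add_le_add_left (measureReal_union_le _ _) _))
    linarith
  -- some choice of the noise does at least as well as the average
  by_contra! hcon
  have hc0 : 0 ≤ c := le_trans (by positivity) (hcon 0 0)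
  refine absurd hG'ge (not_lt.2 (ENNReal.toReal_le_of_le_ofReal hc0 ?_))
  rw [hP, Measure.prod_apply_symm hG'm]
  refine (lintegral_mono (g := fun _ => ENNReal.ofReal c) fun y => ?_).trans (by simp)
  obtain ⟨ζ, ω⟩ := y
  have h1 := hcon ζ ω
  set H := {b | E.NodesBoundedBy M (fun j => (if f b j then 1 else -1) + β * ζ j) ω ∧
        (∀ j, δ ≤ |E.sample (fun j => (if f b j then 1 else -1) + β * ζ j) ω j|) ∧
        signBits (E.sample (fun j => (if f b j then 1 else -1) + β * ζ j) ω) = b} with hH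
  refine (measure_mono (t := {z | signBits z ∈ H}) ?_).trans ((stdNormal_signBits_le H).trans ?_)
  · rintro z ⟨⟨hz1, hz2⟩, hz3⟩
    obtain ⟨hx, hsgn⟩ := hgood (z, ζ) hz3
    change (g z + β • ζ, E.sample (g z + β • ζ) ω) ∈ R at hz1
    change E.NodesBoundedBy M (g z + β • ζ) ω at hz2
    obtain ⟨hz1, hz1'⟩ := hz1
    simp only at hx hsgn hz1 hz1'
    rw [hsgn] at hz1'
    have hinv := hf hz1'
    rw [hx] at hz1 hz2 hinv
    exact ⟨hz2, hz1, hinv⟩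
  · rw [div_le_iff₀ (by positivity)] at h1
    have : (H.ncard : ℝ≥0∞) ≤ ENNReal.ofReal c * 2 ^ d := by
      have h2 : (H.ncard : ℝ≥0∞) = ENNReal.ofReal H.ncard := by simp
      rw [h2]
      refine (ENNReal.ofReal_le_ofReal h1).trans (le_of_eq ?_)
      rw [ENNReal.ofReal_mul hc0, ENNReal.ofReal_pow (by norm_num)]
      simp
    calc _ ≤ ENNReal.ofReal c * 2 ^ d * 2⁻¹ ^ d := by gcongr
      _ = ENNReal.ofReal c := by
        rw [mul_assoc, ← mul_pow, ENNReal.mul_inv_cancel (by simp) (by simp), one_pow, mul_one]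

end

/-! ### Properties of all nodes of an encoder -/

namespace DeepLatentGaussian

theorem AllNets.mono {p q : ∀ a b, NeuralNet a b → Prop} (hpq : ∀ a b N, p a b N → q a b N)
    {a c : ℕ} {E : DeepLatentGaussian a c} (h : E.AllNets p) : E.AllNets q := by
  induction E with
  | single G β => exact hpq _ _ _ h
  | cons G β E ih => exact ⟨hpq _ _ _ h.1, ih h.2⟩

theorem AllNets.and {p q : ∀ a b, NeuralNet a b → Prop} {a c : ℕ} {E : DeepLatentGaussian a c}
    (h : E.AllNets p) (h' : E.AllNets q) : E.AllNets fun a b N => p a b N ∧ q a b N := by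
  induction E with
  | single G β => exact ⟨h, h'⟩
  | cons G β E ih => exact ⟨⟨h.1, h'.1⟩, ih h.2 h'.2⟩

theorem NodesBoundedBy.mono {M M' : ℝ} (hM : M ≤ M') {a c : ℕ} {E : DeepLatentGaussian a c}
    {x : Fin a → ℝ} {ω : ℕ → ℕ → ℝ} (h : E.NodesBoundedBy M x ω) : E.NodesBoundedBy M' x ω := by
  induction E generalizing ω with
  | single G β => exact fun i => (h i).trans hM
  | cons G β E ih => exact ⟨fun i => (h.1 i).trans hM, ih h.2⟩

theorem allNets_admissible {a c : ℕ} {E : DeepLatentGaussian a c} {W Q : ℝ} (hWQ : W ≤ Q)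
    {L : ℝ≥0} {s : ℕ → ℕ} (hW : E.AllNets fun _ _ N => N.WeightsBoundedBy W)
    (hσ : E.AllNets fun _ _ N => N.ActivationsSatisfy fun σ =>
      LipschitzWith L σ ∧ CircuitEvaluable s σ) :
    E.AllNets fun _ _ N => N.prog.AllGates fun _ g => AdmissibleNeuron s L Q g :=
  (hW.and hσ).mono fun _ _ _ h => (Prog.AllGates.and h.1 h.2).mono fun _ _ hg =>
    ⟨⟨fun i => (hg.1.1 i).trans hWQ, hg.1.2.trans hWQ⟩, hg.2⟩

theorem measurableNodes_of_admissible {a c : ℕ} {E : DeepLatentGaussian a c} {Q : ℝ} {L : ℝ≥0}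
    {s : ℕ → ℕ} (h : E.AllNets fun _ _ N => N.prog.AllGates fun _ g => AdmissibleNeuron s L Q g) :
    E.MeasurableNodes :=
  h.mono fun _ _ _ hN => Prog.measurable_wires <| hN.mono fun _ g hg =>
    hg.2.1.continuous.measurable.comp g.preact.measurable_eval

end DeepLatentGaussian

/-! ### Asymptotics -/

theorem eventually_polynomial_le_two_pow (p : Polynomial ℕ) :
    ∀ᶠ d : ℕ in atTop, p.eval d ≤ 2 ^ d := by
  have key : (fun d : ℕ => ((p.eval d : ℕ) : ℝ)) =o[atTop] fun d : ℕ => (2 : ℝ) ^ d := by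
    induction p using Polynomial.induction_on' with
    | add p q hp hq => simpa using hp.add hq
    | monomial n a =>
      simpa using (isLittleO_pow_const_const_pow_of_one_lt (R := ℝ) n one_lt_two).const_mul_left a
  filter_upwards [key.bound one_pos] with d hd
  simp only [one_mul, Real.norm_eq_abs, Nat.abs_cast, abs_pow, Nat.abs_ofNat] at hd
  exact_mod_cast hd

theorem IsLittleOExpPoly.exists_eventually_le {f : ℕ → ℝ} (hf : IsLittleOExpPoly f) :
    ∃ q : Polynomial ℕ, ∀ᶠ d : ℕ in atTop, f d ≤ 2 ^ q.eval d := by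
  obtain ⟨p, hp⟩ := hf
  refine ⟨2 * p, ?_⟩
  filter_upwards [hp.bound one_pos] with d hd
  rw [one_mul, Real.norm_eq_abs, Real.norm_eq_abs, abs_of_pos (Real.exp_pos _)] at hd
  refine (le_abs_self _).trans (hd.trans ?_)
  rw [Polynomial.eval_mul, Polynomial.eval_ofNat, pow_mul, ← Real.exp_one_pow]
  gcongr
  linarith [Real.exp_one_lt_d9]

theorem errGrowth_le {τ q : ℕ} : errGrowth τ (2 ^ q) ≤ 2 ^ (2 * q + τ + 3) := by
  have h1 : (τ : ℝ) ≤ 2 ^ τ := by exact_mod_cast Nat.lt_two_pow_self.le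
  have h2 : (1 : ℝ) ≤ 2 ^ q := one_le_pow₀ one_le_two
  have h3 : (1 : ℝ) ≤ 2 ^ τ := one_le_pow₀ one_le_two
  have h4 : (2 : ℝ) ^ (2 * q + τ + 3) = 8 * (2 ^ τ * (2 ^ q * 2 ^ q)) := by ring
  have h5 : (2 : ℝ) ^ q * 2 ^ q ≤ 2 ^ τ * (2 ^ q * 2 ^ q) :=
    le_mul_of_one_le_left (by positivity) h3
  have h6 : (τ : ℝ) * (2 ^ q * 2 ^ q) ≤ 2 ^ τ * (2 ^ q * 2 ^ q) := by gcongr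
  unfold errGrowth
  rw [h4]
  nlinarith

/-- The choice of the precision, for bounds `2 ^ q` of the weights, values and Lipschitz constants
and at most `τ` parameters. -/
theorem adequatePrecision {d τ q r K : ℕ} (hτ : 1 ≤ τ)
    (hr : r = (2 * q + τ + 3) * τ + 2 * d + (2 * q + τ + 3) + 1) (hrK : r + r ≤ K)
    (hK : 2 * τ * K + 1 ≤ 2 ^ d) :
    AdequatePrecision r K τ (2 ^ q) ∧
      errGrowth τ (2 ^ q) ^ τ * roundErr r K τ < (2⁻¹ : ℝ) ^ d := by
  have h2 : (1 : ℝ) ≤ 2 ^ q := one_le_pow₀ one_le_two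
  refine ⟨⟨hτ, h2, hrK, ?_⟩, ?_⟩
  · have h1 : (τ : ℝ) ≤ 2 ^ τ := by exact_mod_cast Nat.lt_two_pow_self.le
    have h3 : (1 : ℝ) ≤ 2 ^ τ := one_le_pow₀ one_le_two
    have h4 : (1 : ℝ) ≤ 2 ^ τ * 2 ^ q := by nlinarith
    calc ((τ : ℝ) * 2 ^ q + 1) * (2 ^ q + 2)
        ≤ (2 ^ τ * 2 ^ q + 2 ^ τ * 2 ^ q) * (2 ^ q + 2 * 2 ^ q) := by
          gcongr
          linarith
      _ ≤ 2 ^ (2 * q + τ + 3) := by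
          have : (2 : ℝ) ^ (2 * q + τ + 3) = 8 * (2 ^ τ * 2 ^ q * 2 ^ q) := by ring
          rw [this]
          have : (0 : ℝ) ≤ 2 ^ τ * 2 ^ q * 2 ^ q := by positivity
          linarith
      _ ≤ 2 ^ r := pow_le_pow_right₀ one_le_two (by omega)
  · have hg : 0 ≤ errGrowth τ (2 ^ q) := by unfold errGrowth; positivity
    have hK' : (2 * τ * K + 1 : ℝ) ≤ 2 ^ d := by exact_mod_cast hK
    calc errGrowth τ (2 ^ q) ^ τ * roundErr r K τ
        ≤ (2 ^ (2 * q + τ + 3)) ^ τ * (2 ^ d / 2 ^ r) := by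
          unfold roundErr
          gcongr
          exact errGrowth_le
      _ = (2⁻¹ : ℝ) ^ d * 2⁻¹ ^ (2 * q + τ + 3 + 1) := by
          rw [hr, ← pow_mul]
          simp only [inv_pow]
          field_simp
          ring
      _ < (2⁻¹ : ℝ) ^ d := by
          refine mul_lt_of_lt_one_right (by positivity) (pow_lt_one₀ (by norm_num) (by norm_num) ?_)
          omega

theorem IsPolyBounded.exists_net {C : ∀ d, BoolCircuit d d}
    (hC : IsPolyBounded fun d => (C d).size) :
    ∃ G : ∀ d, SgnMinMaxNet d d, IsPolyBounded (fun d => (G d).size) ∧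
      ∀ d (z : Fin d → ℝ), (∀ i, z i ≠ 0) →
        (G d).eval z = fun i => if (C d).eval (signBits z) i then 1 else -1 := by
  choose G hG hGC using fun d => (C d).exists_sgnMinMaxNet
  obtain ⟨p, hp⟩ := hC
  refine ⟨G, ⟨2 * .X + 4 * p, fun d => (hG d).trans ?_⟩, hGC⟩
  have : (C d).size ≤ p.eval d := hp d
  simp only [Polynomial.eval_add, Polynomial.eval_mul, Polynomial.eval_ofNat, Polynomial.eval_X]
  omega

/-- The success probability that is left after the losses: the exceptional set counts with
`d * 2⁻ᵈ + 2 * d * exp (-2 * d)`, the inputs with unbounded nodes with `exp (-d)`. -/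
theorem half_le_of_le_two_pow {d : ℕ} {ε p : ℝ} (hε : 0 < ε) (hp : ε⁻¹ ≤ p)
    (h : 100 * (d + 1) * p ≤ 2 ^ d) :
    ε / 2 ≤ 8 / 10 * (ε - 10 * (d * 2⁻¹ ^ d + d * (2 * Real.exp (-(2 * d))))) -
      Real.exp (-d) - (d * 2⁻¹ ^ d + d * (2 * Real.exp (-(2 * d)))) := by
  have h1 : Real.exp (-d) ≤ (2⁻¹ : ℝ) ^ d := by
    rw [Real.exp_neg, inv_pow, ← Real.exp_one_pow]
    gcongr
    linarith [Real.exp_one_gt_d9]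
  have h2 : Real.exp (-(2 * d)) ≤ (2⁻¹ : ℝ) ^ d :=
    (Real.exp_le_exp.2 (by linarith [(Nat.cast_nonneg d : (0 : ℝ) ≤ d)])).trans h1
  have h3 : (d : ℝ) * (2 * Real.exp (-(2 * d))) ≤ d * (2 * 2⁻¹ ^ d) := by gcongr
  have h4 : 100 * (d + 1) * (2⁻¹ : ℝ) ^ d ≤ ε := by
    have h5 : 100 * (d + 1) ≤ ε * 2 ^ d := by
      calc (100 * (d + 1) : ℝ) = ε * (100 * (d + 1) * ε⁻¹) := by field_simp
        _ ≤ ε * (100 * (d + 1) * p) := by gcongr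
        _ ≤ ε * 2 ^ d := by gcongr
    rw [inv_pow, ← div_eq_mul_inv, div_le_iff₀ (by positivity)]
    exact h5
  have h6 : (0 : ℝ) ≤ 2⁻¹ ^ d := by positivity
  have h7 : (0 : ℝ) ≤ d * 2⁻¹ ^ d := by positivity
  linarith

theorem theorem2 (h_owp : OneWayPermutationsExist) :
    ∃ (C : ∀ d, BoolCircuit d d) (G : ∀ d, SgnMinMaxNet d d),
      -- `C` is a permutation computed by circuits of size `poly(d)`
      IsPolyBounded (fun d => (C d).size) ∧
      (∀ d, Function.Bijective (C d).eval) ∧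
      -- `G` is a network of size `poly(d)` and `G(z) = C(sgn(z))`
      IsPolyBounded (fun d => (G d).size) ∧
      (∀ d (z : Fin d → ℝ), (∀ i, z i ≠ 0) →
        (G d).eval z = fun i => if (C d).eval (fun j => decide (0 < z j)) i then 1 else -1) ∧
      -- no small encoder approximates the posterior
      ∀ β : ℕ → ℝ, (∀ d, 0 < β d) → β =o[atTop] (fun d : ℕ => 1 / √(d : ℝ)) →
      ∀ (T s : ℕ → ℕ) (ε : ℕ → ℝ) (W M : ℕ → ℝ) (L : ℕ → ℝ≥0),
        IsPolyBounded T → IsPolyBounded s → IsInversePoly ε →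
        IsLittleOExpPoly W → IsLittleOExpPoly M → IsLittleOExpPoly (fun d => (L d : ℝ)) →
        ∀ᶠ d in atTop, ∀ E : DeepLatentGaussian d d,
          E.size ≤ T d →
          E.AllNets (fun _ _ N => N.WeightsBoundedBy (W d)) →
          E.AllNets (fun _ _ N => N.ActivationsSatisfy fun σ =>
            LipschitzWith (L d) σ ∧ CircuitEvaluable (fun n => s (d + n)) σ) →
          1 - Real.exp (-(d : ℝ)) ≤
            ((sampleLaw (G d).eval (β d)).prod noiseLaw).real
              {p | E.NodesBoundedBy (M d) p.1 p.2} →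
          (sampleLaw (G d).eval (β d)).real
            {x | tvDist (E.law x) (posteriorLaw (G d).eval (β d) x) ≤ 1 / 10} ≤ ε d := by
  obtain ⟨C, hbij, hsize, hinv⟩ := h_owp
  obtain ⟨G, hGsize, hG⟩ := hsize.exists_net
  refine ⟨C, G, hsize, hbij, hGsize, hG, ?_⟩
  intro β hβ hβo T s ε W M L ⟨tp, hT⟩ ⟨sp, hs⟩ ⟨ep, hε⟩ hW hM hL
  obtain ⟨qW, hqW⟩ := hW.exists_eventually_le
  obtain ⟨qM, hqM⟩ := hM.exists_eventually_le
  obtain ⟨qL, hqL⟩ := hL.exists_eventually_le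
  let q : Polynomial ℕ := qW + qM + qL
  let τ : Polynomial ℕ := tp + 1
  let r : Polynomial ℕ := (2 * q + τ + 3) * τ + 2 * .X + (2 * q + τ + 3) + 1
  let K : Polynomial ℕ := sp.comp (.X + r) + (r + r)
  let N : Polynomial ℕ :=
    (.X + τ) * ((2 * τ * K + 1) * (200 * (r + 1)) + K + 1) + .X
  have hhard := hinv (fun d => N.eval d) (fun d => ε d / 4) ⟨N, fun _ => le_rfl⟩
    ⟨4 * ep, fun d => ⟨by linarith [(hε d).1], by
      have := (hε d).2
      rw [inv_div, div_eq_mul_inv, Polynomial.eval_mul, Polynomial.eval_ofNat]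
      push_cast
      linarith⟩⟩
  filter_upwards [hqW, hqM, hqL, hhard, hβo.bound (c := 1 / 2) (by norm_num), eventually_ge_atTop 1,
    eventually_polynomial_le_two_pow (2 * τ * K + 1),
    eventually_polynomial_le_two_pow (100 * (.X + 1) * ep)]
    with d hqW hqM hqL hhard hβd hd hKd hepd
  intro E hET hEW hEσ hEM
  by_contra! hcon
  have hq : q.eval d = qW.eval d + qM.eval d + qL.eval d := by simp [q]
  have hWQ : W d ≤ 2 ^ q.eval d := hqW.trans (pow_le_pow_right₀ one_le_two (by omega))
  have hMQ : M d ≤ 2 ^ q.eval d := hqM.trans (pow_le_pow_right₀ one_le_two (by omega))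
  have hLQ : (L d : ℝ) ≤ 2 ^ q.eval d := hqL.trans (pow_le_pow_right₀ one_le_two (by omega))
  have hadm := DeepLatentGaussian.allNets_admissible hWQ hEW hEσ
  have hτ : τ.eval d = tp.eval d + 1 := by simp [τ]
  have hK : K.eval d = sp.eval (d + r.eval d) + (r.eval d + r.eval d) := by
    simp [K, Polynomial.eval_comp]
  obtain ⟨hprec, herr⟩ := adequatePrecision (d := d) (τ := τ.eval d) (q := q.eval d)
    (r := r.eval d) (K := K.eval d) (by omega) (by simp [r]) (by omega) (by simpa using hKd)
  have hβ2 : 2 * √d * β d ≤ 1 := by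
    have hd' : (0 : ℝ) < √d := Real.sqrt_pos.2 (by exact_mod_cast hd)
    rw [Real.norm_eq_abs, Real.norm_eq_abs, abs_of_pos (hβ d), abs_of_pos (by positivity)] at hβd
    calc 2 * √d * β d ≤ 2 * √d * (1 / 2 * (1 / √d)) := by gcongr
      _ = 1 := by field_simp
  obtain ⟨ζ, ω, hζω⟩ := exists_noise (hbij d).1 (G d).measurable_eval (hG d)
    (δ := 2⁻¹ ^ d) (by positivity) (measure_exceptional_le (hβ d) hβ2 (by positivity)) E
    (DeepLatentGaussian.measurableNodes_of_admissible hadm) hEM hcon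
    (half_le_of_le_two_pow (hε d).1 (hε d).2 (by
      have : ((Polynomial.eval d (100 * (.X + 1) * ep) : ℕ) : ℝ) ≤ 2 ^ d := by exact_mod_cast hepd
      simpa using this))
  obtain ⟨C', hC'size, hC'⟩ := exists_circuit_sign_sample hprec E (fun j => β d * ζ j) ω
    (hET.trans ((hT d).trans (by simp [τ]))) herr (pow_le_one₀ (by norm_num) (by norm_num)) hLQ
    (by rw [hK]; exact (hs _).trans (Nat.le_add_right _ _)) hadm
  have h1 := hhard C' (hC'size.trans (le_of_eq (by simp [N, nodeCost])))
  refine absurd (hζω.trans_le ((div_le_div_of_nonneg_right (Nat.cast_le.2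
    (Set.ncard_le_ncard ?_)) (by positivity)).trans h1)) (by linarith [(hε d).1])
  rintro b ⟨hb1, hb2, hb3⟩
  exact (hC' _ (hb1.mono hMQ) hb2).trans hb3
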